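/- **Setting.** Let $N\ge 1$ be an integer, $K\in\{1,2,\dots\}\cup\{\infty\}$. For $I=(i_1,\dots,i_N)\in\mathbb N^N$ put $|I|=\sum_j i_j$, $I!=\prod_j i_j!$, and let $\mathcal I_k=\{I\in\mathbb N^N: |I|=2k\}$. For an $N\times N$ matrix $B$, $B_I$ is the $|I|\times|I|$ matrix obtained by repeating the $j$-th row and column of $B$ $i_j$ times. The hafnian of a $2m\times 2m$ matrix is $\mathrm{Haf}(M)=\frac{1}{m!2^m}\sum_{\sigma\in S_{2m}}\prod_{j=1}^m M_{\sigma(2j-1),\sigma(2j)}$ ($=1$ for the empty matrix). Let $\mathcal B$ be the set of real symmetric $N\times N$ matrices with strictly positive entries and all eigenvalues $\lambda_1,\dots,\lambda_N$ in $(0,1)$. For $B\in\mathcal B$ let $b_{\max},b_{\min}$ be its largest and smallest entry and $d=\prod_j\sqrt{1-\lambda_j^2}$. Let $\mathcal A=\prod_{k=0}^K\mathbb R_{\ge0}^{\mathcal I_k}$. It carries the product topology if $K<\infty$ and the box topology (all products of open sets are open) if $K=\infty$. For $a=(a_I)\in\mathcal A$ put $$\mu=\sum_{k=0}^K\sum_{|I|=2k}a_I\,\mathrm{Haf}(B_I),\qquad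 Q^{\text{GBS-P}}=\frac1d\sum_{k_1,k_2=0}^K\ \sum_{|I|=2k_1,\,|J|=2k_2}a_Ia_J\,J!\,\frac{\mathrm{Haf}(B_I)}{\mathrm{Haf}(B_J)},$$ $$Q^{\text{MC}}=\sum_{k_1,k_2=0}^K\ \sum_{|I|=2k_1,\,|J|=2k_2}a_Ia_J\,\mathrm{Haf}(B_{I+J}).$$ For $0<\epsilon,\delta<1$ the guaranteed sample sizes of the GBS probability estimator and of plain Monte Carlo are $$n^{\text{GBS-P}}_{\mathrm{Haf}}=\frac{Q^{\text{GBS-P}}-\mu^2}{\delta\epsilon^2\mu^2},\qquad n^{\text{MC}}_{\mathrm{Haf}}=\frac{Q^{\text{MC}}-\mu^2}{\delta\epsilon^2\mu^2}.$$ Let $\mathcal A_B$ be the set of $a\in\mathcal A$ with $0\ne\mu<\infty$, $Q^{\text{GBS-P}}<\infty$ and $Q^{\text{MC}}<\infty$, and let $\mathcal P=\bigcup_{B\in\mathcal B}\mathcal A_B\times\{B\}\subseteq\mathcal A\times\mathcal B$ with the subspace topology. **Auxiliary functions.** $\mathrm{Li}_{s,K}(z)=\sum_{k=1}^K z^k/k^s$.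 For $k\ge1$ write $2k=Ns_k+r_k$ with integers $s_k\ge 0$, $1\le r_k\le N$; $s_\infty=\infty$; $m_k=(s_k!)^N(s_k+1)^{r_k}$. With $q^-=\min(q,0)$, $$G_{q,K,N}(z)=\sum_{k=1}^{\lfloor N/2\rfloor}\frac{k^q}{(2k)!}z^{2k}+2^{-q^-}(2\pi)^{\frac{N-1}2}N^{q-\frac12}e^{\frac N{12}}\,\mathrm{Li}_{0,N}\!\Big(\frac{2z}N\Big)\mathrm{Li}_{\frac12-\frac N2-q,\,s_K}\!\Big(\frac{z^N}{N^N}\Big),$$ $R_{q,K}(z)=\frac{2^{-q}}{2\sqrt\pi}\mathrm{Li}_{\frac12-q,K}(z)$ if $q\ge0$ and $R_{q,K}(z)=\frac1{2\sqrt\pi}\mathrm{Li}_{\frac12-2q,K}(z)$ if $q<0$. Given $s_1,s_2,\gamma_\alpha,\gamma_\beta>0$ and $q_\alpha,q_\beta\in\mathbb R$, let $$c_1=1+\tfrac1{\sqrt\pi}e^{\frac1{25}-\frac16}\mathrm{Li}_{\frac12-q_\alpha,K}(2\gamma_\alpha b_{\min}),\qquad c_2=1+\tfrac1{\sqrt\pi}\mathrm{Li}_{\frac12-q_\beta,K}(2\gamma_\beta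 b_{\max}),$$ and let $\mathcal B_{\alpha,\beta}$ be the set of $B\in\mathcal B$ such that 1. $c_2^{-1}<c_1^{-1}$, and $c_2^{-1}k^{q_\alpha}\gamma_\alpha^k<c_1^{-1}k^{q_\beta}\gamma_\beta^k$ for all integers $1\le k\le K$; 2. $\displaystyle\frac{s_1}{\epsilon^2\delta}\frac{c_1^{-1}}d\Big(1+G_{q_\beta,K,N}\big(\sqrt{2\gamma_\beta b_{\min}^{-1}}\big)\Big)\le\ln\!\Big(1+2e^{\frac1{25}-\frac16}R_{q_\alpha,K}(4\gamma_\alpha b_{\min})\Big)+2\ln(c_2^{-1})-\ln(\epsilon^2\delta+1)+\frac{s_1}{\epsilon^2\delta}-\ln\max(s_2,1);$ 3. if $K=\infty$: $4\gamma_\beta b_{\max}<1$ and $2\gamma_\beta b_{\min}^{-1}<N^2$. **Conditions on $a\in\mathcal A$.** Some $a_I\neq0$; $c_2^{-1}\mu<a_0<c_1^{-1}\mu$; and for all integers $1\le k\le K$ $$c_2^{-1}\mu\frac{k^{q_\alpha}\gamma_\alpha^k}{k!}\le\sum_{|I|=2k}a_I\le c_1^{-1}\mu\frac{k^{q_\beta}\gamma_\beta^k}{k!},\qquad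 \sum_{|I|=2k}a_I\,I!\le c_1^{-1}\mu\frac{k^{q_\beta}\gamma_\beta^k}{k!}m_k.\tag{$*$}$$ (These conditions include that $\mu$ is finite.) **Theorem.** Let $N\ge1$, $0<\epsilon,\delta<1$ and $s_1,s_2>0$. (i) Let $K\in\{1,2,\dots\}\cup\{\infty\}$, $\gamma_\alpha,\gamma_\beta>0$, $q_\alpha,q_\beta\in\mathbb R$. If $B\in\mathcal B_{\alpha,\beta}$ and $a\in\mathcal A$ satisfies the conditions above, then $a\in\mathcal A_B$ (so both sample sizes are well defined and finite) and $$s_2\exp\!\big(s_1\,n^{\text{GBS-P}}_{\mathrm{Haf}}\big)<n^{\text{MC}}_{\mathrm{Haf}}<\infty.$$ (ii) For all sufficiently large $K$ (including $K=\infty$) there are $\gamma_\alpha,\gamma_\beta>0$, $q_\alpha,q_\beta\in\mathbb R$ and a non-empty open subset $U$ of $\mathcal P$ such that every $(a,B)\in U$ satisfies $B\in\mathcal B_{\alpha,\beta}$ and the conditions on $a$ above. -/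

import Mathlib

open scoped Nat BigOperators

noncomputable section

namespace GaussExp

/-! ### Multi-indices, hafnians -/

/-- The truncation levels `0 ≤ k ≤ K`, where `K` is a natural number or `∞`. -/
abbrev Level (K : ℕ∞) : Type := {k : ℕ // (k : ℕ∞) ≤ K}

/-- The multi-indices `I ∈ ℕ^N` with `|I| = 2k`. -/
abbrev Idx (N k : ℕ) : Type := {I : Fin N → ℕ // ∑ i, I i = 2 * k}

instance instFintypeIdx (N k : ℕ) : Fintype (Idx N k) :=
  Fintype.subtype (Finset.piAntidiag (Finset.univ : Finset (Fin N)) (2 * k)) (by simp)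

/-- `I! = i_1! ⋯ i_N!`. -/
def multiFactorial {N : ℕ} (I : Fin N → ℕ) : ℝ := ∏ i, ((I i)! : ℝ)

/-- The hafnian of an `n × n` matrix: with `n = 2m` it is
`(1 / (m! 2^m)) ∑_σ ∏_{j=1}^m M_{σ(2j-1), σ(2j)}`; it is `0` for odd `n`, and `1` for `n = 0`. -/
def hafnian {n : ℕ} (M : Matrix (Fin n) (Fin n) ℝ) : ℝ :=
  if Even n then
    (1 / (((n / 2)! : ℝ) * 2 ^ (n / 2))) *
      ∑ σ : Equiv.Perm (Fin n), ∏ j : Fin (n / 2),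
        M (σ ⟨2 * (j : ℕ), by have := j.2; omega⟩) (σ ⟨2 * (j : ℕ) + 1, by have := j.2; omega⟩)
  else 0

/-- The `|I| × |I|` matrix `B_I`, in which row and column `m` of `B` are repeated `i_m` times. -/
def repeatMatrix {N : ℕ} (B : Matrix (Fin N) (Fin N) ℝ) (I : Fin N → ℕ) :
    Matrix (Fin (∑ i, I i)) (Fin (∑ i, I i)) ℝ :=
  fun p q => B (finSigmaFinEquiv.symm p).1 (finSigmaFinEquiv.symm q).1

/-- `Haf(B_I)`. -/
def hafRep {N : ℕ} (B : Matrix (Fin N) (Fin N) ℝ) (I : Fin N → ℕ) : ℝ :=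
  hafnian (repeatMatrix B I)

/-! ### The matrices -/

/-- The largest absolute value of an entry. -/
def bMax {N : ℕ} (B : Matrix (Fin N) (Fin N) ℝ) : ℝ := ⨆ p : Fin N × Fin N, |B p.1 p.2|

/-- The smallest entry. -/
def bMin {N : ℕ} (B : Matrix (Fin N) (Fin N) ℝ) : ℝ := ⨅ p : Fin N × Fin N, B p.1 p.2

/-- `d = ∏_j √(1 - λ_j²)`, over the eigenvalues of `B` with multiplicity. -/
def dConst {N : ℕ} (B : Matrix (Fin N) (Fin N) ℝ) : ℝ :=
  (B.charpoly.roots.map fun l => √(1 - l ^ 2)).prod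

/-- The space `𝓑`: symmetric matrices with positive entries and spectrum in `(0, 1)`. -/
def matrixSpace (N : ℕ) : Set (Matrix (Fin N) (Fin N) ℝ) :=
  {B | (∀ i j, 0 < B i j) ∧ B.IsSymm ∧ ∀ l ∈ spectrum ℝ B, 0 < l ∧ l < 1}

/-! ### The coefficients -/

/-- The box topology on a product: all products of open sets are open. -/
@[reducible] def boxTopology {ι : Type*} (X : ι → Type*) [∀ i, TopologicalSpace (X i)] :
    TopologicalSpace (∀ i, X i) :=
  TopologicalSpace.generateFrom
    {s | ∃ u : ∀ i, Set (X i), (∀ i, IsOpen (u i)) ∧ s = Set.univ.pi u}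

/-- With finitely many factors the box topology is the product topology. -/
theorem boxTopology_eq_pi {ι : Type*} [Finite ι] (X : ι → Type*)
    [∀ i, TopologicalSpace (X i)] : boxTopology X = Pi.topologicalSpace := by
  apply le_antisymm
  · rw [pi_eq_generateFrom]
    refine le_generateFrom ?_
    rintro _ ⟨s, F, hs, rfl⟩
    classical
    refine TopologicalSpace.isOpen_generateFrom_of_mem
      ⟨fun i => if i ∈ F then s i else Set.univ, fun i => ?_, ?_⟩
    · by_cases h : i ∈ F
      · simpa [h] using hs i h
      · simp [h]
    · ext x
      simp only [Set.mem_pi, Set.mem_univ, true_imp_iff, Finset.mem_coe]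
      refine forall_congr' fun i => ?_
      by_cases h : i ∈ F <;> simp [h]
  · refine le_generateFrom ?_
    rintro _ ⟨u, hu, rfl⟩
    exact isOpen_set_pi Set.finite_univ fun i _ => hu i

/-- Real coefficient families `(a_I)`, `|I| = 2k`, `0 ≤ k ≤ K`, i.e. `∏_{k=0}^K ℝ^{𝓘_k}`. -/
def Coeff (N : ℕ) (K : ℕ∞) : Type := (k : Level K) → Idx N k.1 → ℝ

/-- For `K < ∞` this is the product topology (`boxTopology_eq_pi`). -/
instance instTopologicalSpaceCoeff (N : ℕ) (K : ℕ∞) : TopologicalSpace (Coeff N K) :=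
  boxTopology fun k : Level K => Idx N k.1 → ℝ

variable {N : ℕ} {K : ℕ∞}

/-- The family has nonnegative entries. -/
def Nonneg (a : Coeff N K) : Prop := ∀ k I, 0 ≤ a k I

/-- The coefficient `a_0` of the zero multi-index. -/
def coeffZero (a : Coeff N K) : ℝ := a ⟨0, by simp⟩ ⟨0, by simp⟩

/-- The terms `∑_{|I|=2k} a_I Haf(B_I)` of `μ_Haf`. -/
def muTerm (a : Coeff N K) (B : Matrix (Fin N) (Fin N) ℝ) (k : Level K) : ℝ :=
  ∑ I, a k I * hafRep B I.1

/-- `μ_Haf`. -/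
def muHaf (a : Coeff N K) (B : Matrix (Fin N) (Fin N) ℝ) : ℝ := ∑' k, muTerm a B k

/-- The terms of `Q^{GBS-P}`, before division by `d`. -/
def gbspTerm (a : Coeff N K) (B : Matrix (Fin N) (Fin N) ℝ) (p : Level K × Level K) : ℝ :=
  ∑ I, ∑ J, a p.1 I * a p.2 J * multiFactorial J.1 * (hafRep B I.1 / hafRep B J.1)

/-- `Q^{GBS-P}_Haf`. -/
def qGBSP (a : Coeff N K) (B : Matrix (Fin N) (Fin N) ℝ) : ℝ :=
  (1 / dConst B) * ∑' p, gbspTerm a B p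

/-- The terms of `Q^{MC}`. -/
def mcTerm (a : Coeff N K) (B : Matrix (Fin N) (Fin N) ℝ) (p : Level K × Level K) : ℝ :=
  ∑ I, ∑ J, a p.1 I * a p.2 J * hafRep B (I.1 + J.1)

/-- `Q^{MC}_Haf`. -/
def qMC (a : Coeff N K) (B : Matrix (Fin N) (Fin N) ℝ) : ℝ := ∑' p, mcTerm a B p

/-- The guaranteed sample size `n^{GBS-P}_Haf`. -/
def nGBSP (ε δ : ℝ) (a : Coeff N K) (B : Matrix (Fin N) (Fin N) ℝ) : ℝ :=
  (qGBSP a B - muHaf a B ^ 2) / (δ * ε ^ 2 * muHaf a B ^ 2)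

/-- The guaranteed sample size `n^{MC}_Haf`. -/
def nMC (ε δ : ℝ) (a : Coeff N K) (B : Matrix (Fin N) (Fin N) ℝ) : ℝ :=
  (qMC a B - muHaf a B ^ 2) / (δ * ε ^ 2 * muHaf a B ^ 2)

/-- The space `𝓐_B` of nonnegative families for which `μ_Haf ≠ 0` and the series defining
`μ_Haf`, `Q^{GBS-P}_Haf` and `Q^{MC}_Haf` are finite, so that the problem and both guaranteed
sample sizes are well defined and finite. -/
def coeffSpace (K : ℕ∞) (B : Matrix (Fin N) (Fin N) ℝ) : Set (Coeff N K) :=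
  {a | Nonneg a ∧ Summable (muTerm a B) ∧ muHaf a B ≠ 0 ∧
    Summable (gbspTerm a B) ∧ Summable (mcTerm a B)}

/-- The problem space `𝓟 = ⋃_{B ∈ 𝓑} 𝓐_B × {B}`. -/
def problemSpace (N : ℕ) (K : ℕ∞) : Set (Coeff N K × Matrix (Fin N) (Fin N) ℝ) :=
  {p | p.2 ∈ matrixSpace N ∧ p.1 ∈ coeffSpace K p.2}

/-! ### The comparison functions -/

open Classical in
/-- The truncated polylogarithm `Li_{s,K}(z) = ∑_{k=1}^K z^k / k^s`, `K ≤ ∞`. -/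
def polylog (s : ℝ) (K : ℕ∞) (z : ℝ) : ℝ :=
  ∑' k : ℕ, if 1 ≤ k ∧ (k : ℕ∞) ≤ K then z ^ k / (k : ℝ) ^ s else 0

/-- The integer `s_k` with `2k = N s_k + r_k`, `1 ≤ r_k ≤ N`, for `k ≥ 1` (and `s_0 = 0`). -/
def sIdx (N k : ℕ) : ℕ := (2 * k - 1) / N

/-- The integer `r_k` with `2k = N s_k + r_k`, `1 ≤ r_k ≤ N`, for `k ≥ 1` (and `r_0 = 0`). -/
def rIdx (N k : ℕ) : ℕ := 2 * k - N * sIdx N k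

/-- `s_K`, with `s_∞ = ∞`. -/
def sTop (N : ℕ) (K : ℕ∞) : ℕ∞ := ENat.map (sIdx N) K

/-- `m_k = (s_k!)^N (s_k + 1)^{r_k}`. -/
def mIdx (N k : ℕ) : ℝ := ((sIdx N k)! : ℝ) ^ N * ((sIdx N k : ℝ) + 1) ^ rIdx N k

/-- `∑_{k=1}^n k^q z^{2k} / (2k)!`. -/
def hFun (q : ℝ) (n : ℕ) (z : ℝ) : ℝ :=
  ∑ k ∈ Finset.Icc 1 n, (k : ℝ) ^ q / ((2 * k)! : ℝ) * z ^ (2 * k)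

/-- The function `G_{q,K,N}`. -/
def gFun (q : ℝ) (K : ℕ∞) (N : ℕ) (z : ℝ) : ℝ :=
  hFun q (N / 2) z +
    (2 : ℝ) ^ (-min q 0) * (2 * Real.pi) ^ (((N : ℝ) - 1) / 2) * (N : ℝ) ^ (q - 1 / 2) *
      Real.exp ((N : ℝ) / 12) * polylog 0 (N : ℕ∞) (2 * z / N) *
      polylog (1 / 2 - (N : ℝ) / 2 - q) (sTop N K) (z ^ N / (N : ℝ) ^ N)

/-- The function `R_{q,K}`. -/
def rFun (q : ℝ) (K : ℕ∞) (z : ℝ) : ℝ :=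
  if 0 ≤ q then (2 : ℝ) ^ (-q) * (1 / (2 * √Real.pi)) * polylog (1 / 2 - q) K z
  else 1 / (2 * √Real.pi) * polylog (1 / 2 - 2 * q) K z

/-- The constant `e^{1/25 - 1/6}`. -/
def eConst : ℝ := Real.exp (1 / 25 - 1 / 6)

/-- The constant `c_1`. -/
def cOne (K : ℕ∞) (γα qα : ℝ) (B : Matrix (Fin N) (Fin N) ℝ) : ℝ :=
  1 + 1 / √Real.pi * eConst * polylog (1 / 2 - qα) K (2 * γα * bMin B)

/-- The constant `c_2`. -/
def cTwo (K : ℕ∞) (γβ qβ : ℝ) (B : Matrix (Fin N) (Fin N) ℝ) : ℝ :=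
  1 + 1 / √Real.pi * polylog (1 / 2 - qβ) K (2 * γβ * bMax B)

/-- The set `𝓑_{α,β}`. -/
def matrixSubset (N : ℕ) (K : ℕ∞) (ε δ s₁ s₂ γα γβ qα qβ : ℝ) :
    Set (Matrix (Fin N) (Fin N) ℝ) :=
  {B | B ∈ matrixSpace N ∧
    (cTwo K γβ qβ B)⁻¹ < (cOne K γα qα B)⁻¹ ∧
    (∀ k : ℕ, 1 ≤ k → (k : ℕ∞) ≤ K →
      (cTwo K γβ qβ B)⁻¹ * ((k : ℝ) ^ qα * γα ^ k) <
        (cOne K γα qα B)⁻¹ * ((k : ℝ) ^ qβ * γβ ^ k)) ∧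
    s₁ / (ε ^ 2 * δ) * ((cOne K γα qα B)⁻¹ / dConst B) *
        (1 + gFun qβ K N (√(2 * γβ * (bMin B)⁻¹))) ≤
      Real.log (1 + 2 * eConst * rFun qα K (4 * γα * bMin B)) +
        2 * Real.log (cTwo K γβ qβ B)⁻¹ - Real.log (ε ^ 2 * δ + 1) +
        s₁ / (ε ^ 2 * δ) - Real.log (max s₂ 1) ∧
    (K = ⊤ → 4 * γβ * bMax B < 1 ∧ 2 * γβ * (bMin B)⁻¹ < (N : ℝ) ^ 2)}

/-- The conditions on the coefficients. -/
def CoeffConditions (γα γβ qα qβ : ℝ) (a : Coeff N K) (B : Matrix (Fin N) (Fin N) ℝ) : Prop :=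
  (∃ k I, a k I ≠ 0) ∧
  (cTwo K γβ qβ B)⁻¹ * muHaf a B < coeffZero a ∧
  coeffZero a < (cOne K γα qα B)⁻¹ * muHaf a B ∧
  ∀ k : Level K, 1 ≤ k.1 →
    (cTwo K γβ qβ B)⁻¹ * muHaf a B * ((k.1 : ℝ) ^ qα * γα ^ k.1 / (k.1 ! : ℝ)) ≤ ∑ I, a k I ∧
    ∑ I, a k I ≤
      (cOne K γα qα B)⁻¹ * muHaf a B * ((k.1 : ℝ) ^ qβ * γβ ^ k.1 / (k.1 ! : ℝ)) ∧
    ∑ I, a k I * multiFactorial I.1 ≤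
      (cOne K γα qα B)⁻¹ * muHaf a B * ((k.1 : ℝ) ^ qβ * γβ ^ k.1 / (k.1 ! : ℝ)) * mIdx N k.1

end GaussExp

end

noncomputable section

namespace GaussExp

open Finset

/-! Part (i) sandwiches the two second moments. All entries of `B` lie between `bMin B` and `bMax
B`, so for |I| = 2k the hafnian Haf(B_I) lies between b_min^k (2k-1)!! and b_max^k (2k-1)!!, and the
sums over one level reduce to the level sums controlled by the coefficient conditions. The GBS-P
moment factors as (μ/d) Σ_J a_J J!/Haf(B_J); Stirling's formula, applied with 2k = N s_k + r_k,
bounds it by c₁⁻¹ μ² (1 + G)/d (`gbsp_bounds`). Grouping the Monte Carlo moment by total degree k₁ +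
k₂ bounds it below by (c₂⁻¹ μ)² (1 + 2 e^{1/25-1/6} R) (`lt_qMC`). Condition 2 on `B` is the
logarithm of the comparison needed between these two bounds (`lt_of_log_bound`).

That comparison also uses n^{GBS-P} ≥ 0, that is μ² ≤ Q^{GBS-P}, which comes from Haf(B_I)² ≤ I!
(`hafRep_sq_le`). For the latter, take a positive vector x with Bx ≤ x. Expanding two hafnians
alternately along rows is like expanding a permanent, and the rescaling by x bounds each row
expansion (`mul_le_permBound`). The row expansion itself is the derivative of a power of the
quadratic form of `B`, whose coefficients are hafnians.

Part (ii) takes γ_α = γ_β = 5N/16, q_α = q_β = 0 and entries of `B` slightly below 4/(5N). Then 4γb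
is slightly below 1, so R, a partial sum of Σ k^{-1/2} z^k with z near 1, becomes arbitrarily large
with K. Meanwhile the spectrum stays below 4/5 and 2γ/b_min below (7/8)N², so 1/d and G stay bounded
independently of K. For level sums near γ^k/k!, μ is near Σ_k binom(2k,k)(γb/2)^k, and
e^{1/25-1/6}/√(πk) < binom(2k,k)/4^k ≤ 1/√(πk) places it between c₁ and c₂. The gap at k = 1 does
not depend on K, which leaves room for an open set. -/

/-- The `i`-th unit multi-index. -/
abbrev unitIndex {N : ℕ} (i : Fin N) : Fin N → ℕ := Pi.single i 1

/-! ### Sums over permutations and coefficients of powers of quadratic forms -/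

/-- If one such permutation exists, all of them form a coset of the stabilizer of `f`, whose order
is the product of the factorials of the fibre sizes; one exists exactly when the fibres match in
size. -/
theorem card_perm_comp_eq {α ι : Type*} [Fintype α] [DecidableEq α] [Fintype ι] [DecidableEq ι]
    (f g : α → ι) :
    (univ.filter fun σ : Equiv.Perm α => f ∘ σ = g).card =
      if ∀ i, Fintype.card {a // g a = i} = Fintype.card {a // f a = i} then
        ∏ i, (Fintype.card {a // f a = i})! else 0 := by
  split_ifs with h
  · have e : ∀ i, {a // g a = i} ≃ {a // f a = i} := fun i =>
      Fintype.equivOfCardEq (h i)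
    let σ₀ : Equiv.Perm α :=
      (Equiv.sigmaFiberEquiv g).symm.trans
        ((Equiv.sigmaCongrRight fun i => (e i)).trans (Equiv.sigmaFiberEquiv f))
    have hσ : f ∘ σ₀ = g := by
      funext a
      exact (e (g a) ⟨a, rfl⟩).2
    rw [← DomMulAct.stabilizer_card f, ← Fintype.card_subtype]
    refine Fintype.card_congr ((Equiv.mulRight σ₀⁻¹).subtypeEquiv fun σ => ?_)
    rw [← hσ]
    constructor
    · intro h'
      funext a
      have := congrFun h' (σ₀⁻¹ a)
      simpa using this
    · intro h'
      funext a
      have := congrFun h' (σ₀ a)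
      simpa using this
  · rw [card_eq_zero, filter_eq_empty_iff]
    intro σ _ hσ
    apply h
    intro i
    refine Fintype.card_congr (σ.subtypeEquiv fun a => ?_)
    rw [← hσ]; rfl

theorem sum_perm_comp {α ι : Type*} [Fintype α] [DecidableEq α] [Fintype ι] [DecidableEq ι]
    (f : α → ι) (F : (α → ι) → ℝ) :
    ∑ σ : Equiv.Perm α, F (f ∘ σ) =
      ((∏ i, (Fintype.card {a // f a = i})! : ℕ) : ℝ) *
        ∑ g : α → ι, if ∀ i, Fintype.card {a // g a = i} = Fintype.card {a // f a = i} then F g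
          else 0 := by
  rw [← Finset.sum_fiberwise univ (fun σ : Equiv.Perm α => f ∘ σ), mul_sum]
  refine sum_congr rfl fun g _ => ?_
  rw [sum_congr rfl (g := fun _ => F g) fun σ hσ => by rw [(mem_filter.1 hσ).2], sum_const,
    card_perm_comp_eq]
  split_ifs <;> simp

/-- The quadratic form `∑_{a,b} B_{ab} X_a X_b`. -/
def quadForm {N : ℕ} (B : Matrix (Fin N) (Fin N) ℝ) : MvPolynomial (Fin N) ℝ :=
  ∑ p : Fin N × Fin N, MvPolynomial.monomial (Finsupp.single p.1 1 + Finsupp.single p.2 1)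
    (B p.1 p.2)

/-- Functions on `2k` points are functions from `k` points to pairs. -/
def pairingEquiv {n k : ℕ} (h : n = k * 2) (ι : Type*) : (Fin n → ι) ≃ (Fin k → ι × ι) :=
  ((finProdFinEquiv.trans (finCongr h.symm)).arrowCongr (Equiv.refl ι)).symm.trans
    ((Equiv.curry (Fin k) (Fin 2) ι).trans ((Equiv.refl (Fin k)).arrowCongr (finTwoArrowEquiv ι)))

theorem sum_single_eq_iff {N n : ℕ} (g : Fin n → Fin N) (c : Fin N →₀ ℕ) :
    ∑ p, Finsupp.single (g p) 1 = c ↔ ∀ i, Fintype.card {a // g a = i} = c i := by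
  rw [Finsupp.ext_iff]
  refine forall_congr' fun i => ?_
  rw [Finsupp.finsetSum_apply, Fintype.card_subtype, card_filter]
  simp [Finsupp.single_apply]

theorem coeff_quadForm_pow {N n k : ℕ} (h : n = k * 2) (B : Matrix (Fin N) (Fin N) ℝ)
    (c : Fin N →₀ ℕ) :
    (quadForm B ^ k).coeff c =
      ∑ g : Fin n → Fin N, if ∀ i, Fintype.card {a // g a = i} = c i then
        ∏ j, B (pairingEquiv h _ g j).1 (pairingEquiv h _ g j).2 else 0 := by
  rw [quadForm, Fintype.sum_pow, MvPolynomial.coeff_sum, ← (pairingEquiv h (Fin N)).sum_comp]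
  refine sum_congr rfl fun g _ => ?_
  have : ∀ (u : Fin k → Fin N × Fin N), (∏ j, MvPolynomial.monomial
      (Finsupp.single (u j).1 1 + Finsupp.single (u j).2 1) (B (u j).1 (u j).2)) =
      MvPolynomial.monomial (∑ j, (Finsupp.single (u j).1 1 + Finsupp.single (u j).2 1))
        (∏ j, B (u j).1 (u j).2) := fun u => by
    induction (univ : Finset (Fin k)) using Finset.induction_on with
    | empty => simp
    | insert a s ha ih =>
      rw [prod_insert ha, prod_insert ha, sum_insert ha, ih, MvPolynomial.monomial_mul]
  rw [this, MvPolynomial.coeff_monomial]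
  refine if_congr ?_ rfl rfl
  rw [← sum_single_eq_iff, ← (finProdFinEquiv.trans (finCongr h.symm)).sum_comp,
    Fintype.sum_prod_type]
  simp only [Fin.sum_univ_two]
  rfl

theorem hafnian_eq {n k : ℕ} (h : n = k * 2) (M : Matrix (Fin n) (Fin n) ℝ) :
    hafnian M = 1 / ((k ! : ℝ) * 2 ^ k) * ∑ σ : Equiv.Perm (Fin n), ∏ j : Fin k,
      M (σ (Fin.cast h.symm (finProdFinEquiv (j, (0 : Fin 2)))))
        (σ (Fin.cast h.symm (finProdFinEquiv (j, (1 : Fin 2))))) := by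
  subst h
  have h2 : k * 2 / 2 = k := by omega
  rw [hafnian, if_pos (by simp)]
  congr 1
  · rw [h2]
  · refine sum_congr rfl fun σ _ => ?_
    refine Fintype.prod_equiv (finCongr h2) _ _ fun j => ?_
    have e0 : (⟨2 * (j : ℕ), by omega⟩ : Fin (k * 2)) =
        Fin.cast rfl (finProdFinEquiv (finCongr h2 j, (0 : Fin 2))) := by
      ext; simp
    have e1 : (⟨2 * (j : ℕ) + 1, by omega⟩ : Fin (k * 2)) =
        Fin.cast rfl (finProdFinEquiv (finCongr h2 j, (1 : Fin 2))) := by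
      ext; simp [add_comm]
    rw [e0, e1]

theorem card_fiber_finSigma {N : ℕ} (I : Fin N → ℕ) (i : Fin N) :
    Fintype.card {p : Fin (∑ i, I i) // (finSigmaFinEquiv.symm p).1 = i} = I i := by
  rw [← Fintype.card_fin (I i)]
  refine Fintype.card_congr (Equiv.trans ?_ (Equiv.sigmaSubtype (β := fun i => Fin (I i)) i))
  exact finSigmaFinEquiv.symm.subtypeEquiv fun p => Iff.rfl

/-- Each labelling of the 2k points with fibre sizes I is induced by I! permutations, and these
labellings are the ways to pick one monomial from each of the k factors of the power. This form
allows hafnians to be studied by differentiation. -/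
theorem hafRep_eq_coeff {N k : ℕ} (B : Matrix (Fin N) (Fin N) ℝ) (I : Fin N → ℕ)
    (hI : ∑ i, I i = k * 2) :
    hafRep B I = multiFactorial I / ((k ! : ℝ) * 2 ^ k) *
      (quadForm B ^ k).coeff (Finsupp.equivFunOnFinite.symm I) := by
  rw [hafRep, hafnian_eq hI, coeff_quadForm_pow hI]
  have := sum_perm_comp (fun p : Fin (∑ i, I i) => (finSigmaFinEquiv.symm p).1)
    (fun g => ∏ j, B (pairingEquiv hI _ g j).1 (pairingEquiv hI _ g j).2)
  simp only [card_fiber_finSigma] at this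
  rw [show multiFactorial I = ((∏ i, (I i)! : ℕ) : ℝ) by simp [multiFactorial]]
  simp only [Finsupp.equivFunOnFinite_symm_apply_apply]
  rw [one_div, inv_mul_eq_div, div_mul_eq_mul_div, ← this]
  rfl

theorem hafRep_odd {N : ℕ} (B : Matrix (Fin N) (Fin N) ℝ) (I : Fin N → ℕ)
    (hI : ¬ Even (∑ i, I i)) : hafRep B I = 0 := by
  rw [hafRep, hafnian, if_neg hI]

@[simp] theorem hafRep_zero {N : ℕ} (B : Matrix (Fin N) (Fin N) ℝ) : hafRep B 0 = 1 := by
  rw [hafRep_eq_coeff (k := 0) B 0 (by simp)]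
  simp [multiFactorial, MvPolynomial.coeff_one, Finsupp.ext_iff]

theorem pderiv_quadForm {N : ℕ} {B : Matrix (Fin N) (Fin N) ℝ} (hB : B.IsSymm) (i : Fin N) :
    MvPolynomial.pderiv i (quadForm B) =
      ∑ b, MvPolynomial.C (2 * B i b) * MvPolynomial.X b := by
  have h : quadForm B = ∑ a, ∑ b, MvPolynomial.C (B a b) *
      (MvPolynomial.X a * MvPolynomial.X b) := by
    rw [quadForm, Fintype.sum_prod_type]
    refine sum_congr rfl fun a _ => sum_congr rfl fun b _ => ?_
    rw [MvPolynomial.X, MvPolynomial.X, MvPolynomial.monomial_mul, MvPolynomial.C_mul_monomial]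
    simp
  have hs : ∀ a b, B a b = B b a := fun a b => hB.apply b a
  rw [h]
  simp only [map_sum, Derivation.leibniz, MvPolynomial.pderiv_C, smul_eq_mul,
    MvPolynomial.pderiv_X, mul_add, sum_add_distrib]
  simp only [Pi.single_apply, mul_ite, mul_one, mul_zero, sum_ite_eq',
    mem_univ, if_true]
  rw [sum_comm (f := fun x b => if x = i then MvPolynomial.C (B x b) * MvPolynomial.X b else 0)]
  simp only [sum_ite_eq', mem_univ, if_true, sum_const_zero, add_zero]
  rw [← sum_add_distrib]
  refine sum_congr rfl fun b _ => ?_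
  rw [hs b i, two_mul, map_add]
  ring

theorem multiFactorial_add_single {N : ℕ} (J : Fin N → ℕ) (i : Fin N) :
    multiFactorial (J + unitIndex i) = (J i + 1) * multiFactorial J := by
  rw [multiFactorial, multiFactorial, ← mul_prod_erase univ _ (mem_univ i),
    ← mul_prod_erase univ (fun j => ((J j)! : ℝ)) (mem_univ i), ← mul_assoc]
  congr 1
  · simp [Nat.factorial_succ]
  · refine prod_congr rfl fun j hj => ?_
    simp [(mem_erase.1 hj).1]

theorem sub_single_add_single {N : ℕ} {J : Fin N → ℕ} {i : Fin N} (h : J i ≠ 0) :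
    J - unitIndex i + unitIndex i = J := by
  funext j
  by_cases hj : j = i
  · subst hj; simp; omega
  · simp [hj]

theorem sum_add_single {N : ℕ} (J : Fin N → ℕ) (i : Fin N) :
    ∑ j, (J + unitIndex i) j = ∑ j, J j + 1 := by
  simp [sum_add_distrib]

/-- Expansion of the hafnian along a row. -/
theorem hafRep_add_single {N : ℕ} {B : Matrix (Fin N) (Fin N) ℝ} (hB : B.IsSymm)
    (J : Fin N → ℕ) (i : Fin N) :
    hafRep B (J + unitIndex i) = ∑ b, B i b * J b * hafRep B (J - unitIndex b) := by
  have hs : ∀ b, J b ≠ 0 → ∑ j, (J - unitIndex b) j + 1 = ∑ j, J j := fun b hb => by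
    rw [← sum_add_single _ b, sub_single_add_single hb]
  by_cases hodd : Even (∑ j, J j)
  · rw [hafRep_odd]
    · symm
      refine sum_eq_zero fun b _ => ?_
      by_cases hb : J b = 0
      · simp [hb]
      · rw [hafRep_odd, mul_zero]
        rw [← hs b hb] at hodd
        exact fun h => (Nat.even_add_one.1 hodd) h
    · rw [sum_add_single]
      exact fun h => (Nat.even_add_one.1 h) hodd
  · obtain ⟨k, hk⟩ := Nat.not_even_iff_odd.1 hodd
    rw [hafRep_eq_coeff (k := k + 1) B _ (by rw [sum_add_single]; omega)]
    -- With q the quadratic form, the expansion is the comparison of coefficients of x^J in ∂_i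
    -- q^{k+1} = (k+1) q^k ∂_i q.
    have h1 := MvPolynomial.coeff_pderiv (i := i) (quadForm B ^ (k + 1))
      (Finsupp.equivFunOnFinite.symm J)
    have h2 : (Finsupp.equivFunOnFinite.symm J + Finsupp.single i 1 : Fin N →₀ ℕ) =
        Finsupp.equivFunOnFinite.symm (J + unitIndex i) := by
      ext j; simp [Finsupp.single_apply, Pi.single_apply, eq_comm]
    rw [h2] at h1
    rw [Derivation.leibniz_pow, pderiv_quadForm hB] at h1
    simp only [add_tsub_cancel_right, smul_eq_mul, mul_sum, nsmul_eq_mul] at h1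
    rw [MvPolynomial.coeff_sum] at h1
    have h3 : ∀ b, MvPolynomial.coeff (Finsupp.equivFunOnFinite.symm J)
        (((k + 1 : ℕ) : MvPolynomial (Fin N) ℝ) *
          (quadForm B ^ k * (MvPolynomial.C (2 * B i b) * MvPolynomial.X b))) =
        (k + 1) * 2 * B i b * (if J b ≠ 0 then
          (quadForm B ^ k).coeff (Finsupp.equivFunOnFinite.symm (J - unitIndex b)) else 0) := by
      intro b
      have : (((k + 1 : ℕ) : MvPolynomial (Fin N) ℝ) *
          (quadForm B ^ k * (MvPolynomial.C (2 * B i b) * MvPolynomial.X b))) =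
          MvPolynomial.C ((k + 1) * 2 * B i b) * (quadForm B ^ k * MvPolynomial.X b) := by
        simp only [map_mul, map_add, map_one, map_natCast, map_ofNat, Nat.cast_add, Nat.cast_one]
        ring
      rw [this, MvPolynomial.coeff_C_mul, MvPolynomial.coeff_mul_X']
      congr 1
      refine if_congr (by simp) ?_ rfl
      congr 1
      ext j; simp [Finsupp.single_apply, Pi.single_apply, eq_comm]
    simp only [h3] at h1
    have h4 : ∀ b, B i b * J b * hafRep B (J - unitIndex b) =
        multiFactorial J / ((k ! : ℝ) * 2 ^ k) * (B i b * (if J b ≠ 0 then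
          (quadForm B ^ k).coeff (Finsupp.equivFunOnFinite.symm (J - unitIndex b)) else 0)) := by
      intro b
      by_cases hb : J b = 0
      · simp [hb]
      · rw [hafRep_eq_coeff (k := k) B _ (by have := hs b hb; omega), if_pos hb]
        have : multiFactorial J = J b * multiFactorial (J - unitIndex b) := by
          conv_lhs => rw [← sub_single_add_single hb]
          rw [multiFactorial_add_single]
          congr 1
          have : 1 ≤ J b := Nat.one_le_iff_ne_zero.2 hb
          simp [Nat.cast_sub this]
        rw [this]
        ring
    simp only [h4]
    rw [← mul_sum, multiFactorial_add_single]
    have h5 : (MvPolynomial.coeff (Finsupp.equivFunOnFinite.symm (J + unitIndex i))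
        (quadForm B ^ (k + 1))) * ((J i : ℝ) + 1) = (k + 1) * 2 *
        ∑ b, B i b * (if J b ≠ 0 then
          (quadForm B ^ k).coeff (Finsupp.equivFunOnFinite.symm (J - unitIndex b)) else 0) := by
      rw [mul_sum]
      simp only [← mul_assoc]
      simpa only [mul_assoc, Finsupp.equivFunOnFinite_symm_apply_apply] using h1.symm
    rw [Nat.factorial_succ, pow_succ]
    push_cast
    have hk0 : (k ! : ℝ) ≠ 0 := by positivity
    field_simp
    linear_combination multiFactorial J * h5

/-! ### `Haf(B_I)² ≤ I!` -/

section Recursion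

variable {N : ℕ} {B : Matrix (Fin N) (Fin N) ℝ} {x : Fin N → ℝ} {H : (Fin N → ℕ) → ℝ}

/-- `C! x^R / x^C`, an upper bound for the permanent of the matrix with rows `R`, columns `C`. -/
def permBound (x : Fin N → ℝ) (R C : Fin N → ℕ) : ℝ :=
  multiFactorial C * ((∏ i, x i ^ R i) / ∏ i, x i ^ C i)

theorem multiFactorial_pos (I : Fin N → ℕ) : 0 < multiFactorial I :=
  prod_pos fun i _ => by positivity

theorem prod_pow_add_single (x : Fin N → ℝ) (R : Fin N → ℕ) (i : Fin N) :
    ∏ j, x j ^ (R + unitIndex i) j = x i * ∏ j, x j ^ R j := by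
  simp only [Pi.add_apply, pow_add, prod_mul_distrib]
  rw [mul_comm, prod_eq_single_of_mem i (mem_univ i) fun j _ hj => by simp [hj]]
  simp

/-- Removing a column b turns the factor `C b` and the factorial back into C! and contributes x_b.
What remains is Σ_b B_ib x_b ≤ x_i, so the bound is a supersolution of the row expansion of
permanents. -/
theorem permBound_step (hx : ∀ i, 0 < x i) (hB : ∀ i j, 0 ≤ B i j)
    (hBx : ∀ i, ∑ j, B i j * x j ≤ x i) (R C : Fin N → ℕ) (i : Fin N) :
    ∑ b, B i b * C b * permBound x R (C - unitIndex b) ≤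
      permBound x (R + unitIndex i) C := by
  have hR : 0 < ∏ i, x i ^ R i := prod_pos fun i _ => pow_pos (hx i) _
  have hC : 0 < ∏ i, x i ^ C i := prod_pos fun i _ => pow_pos (hx i) _
  have hm := multiFactorial_pos C
  calc ∑ b, B i b * C b * permBound x R (C - unitIndex b)
      ≤ ∑ b, permBound x R C * (B i b * x b) := by
        refine sum_le_sum fun b _ => ?_
        by_cases hb : C b = 0
        · have := hB i b
          have := hx b
          simp only [hb, permBound]
          simp only [Nat.cast_zero, mul_zero, zero_mul]
          positivity
        · apply le_of_eq
          have h1 := prod_pow_add_single x (C - unitIndex b) b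
          rw [sub_single_add_single hb] at h1
          have h2 := multiFactorial_add_single (C - unitIndex b) b
          rw [sub_single_add_single hb] at h2
          have h3 : (((C - unitIndex b : Fin N → ℕ) b : ℕ) : ℝ) + 1 = C b := by
            have : 1 ≤ C b := Nat.one_le_iff_ne_zero.2 hb
            simp [Nat.cast_sub this]
          have hC' : 0 < ∏ i, x i ^ (C - unitIndex b) i := prod_pos fun i _ => pow_pos (hx i) _
          have := (hx b).ne'
          rw [permBound, permBound, h1, h2, h3]
          field_simp
    _ = permBound x R C * ∑ b, B i b * x b := by rw [mul_sum]
    _ ≤ permBound x R C * x i := by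
        refine mul_le_mul_of_nonneg_left (hBx i) ?_
        unfold permBound
        positivity
    _ = permBound x (R + unitIndex i) C := by
        rw [permBound, permBound, prod_pow_add_single]
        ring

/-- The induction must leave the diagonal D = E: expanding one hafnian along a row and then the
other along the matched index leaves two multi-indices that again differ by exchanging one unit,
with a total smaller by 2. Each of the two expansions is absorbed by one `permBound_step`. -/
theorem mul_le_permBound (hx : ∀ i, 0 < x i) (hB : ∀ i j, 0 ≤ B i j)
    (hBx : ∀ i, ∑ j, B i j * x j ≤ x i) (hH0 : H 0 = 1)
    (hrec : ∀ J i, H (J + unitIndex i) = ∑ b, B i b * J b * H (J - unitIndex b)) :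
    ∀ (n : ℕ) (D E : Fin N → ℕ) (p j : Fin N), ∑ i, D i = n →
      E + unitIndex p = D + unitIndex j → H D * H E ≤ permBound x D E := by
  intro n
  induction n using Nat.strong_induction_on with
  | _ n ih =>
  intro D E p j hD hE
  by_cases hD0 : D = 0
  · have hE0 : E = 0 := by
      have h1 : ∑ i, E i + 1 = ∑ i, D i + 1 := by rw [← sum_add_single E p, hE, sum_add_single]
      have h2 : ∑ i, E i = 0 := by rw [hD0] at h1; simpa using h1
      funext i
      exact (sum_eq_zero_iff.1 h2) i (mem_univ i)
    subst hD0; subst hE0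
    simp [permBound, multiFactorial, hH0]
  -- The row p to be expanded must occur in D. If it does not, the relation at p forces p = j, hence
  -- E = D, and any index occurring in D may replace p.
  obtain ⟨p, j, hE, hp⟩ : ∃ p j, E + unitIndex p = D + unitIndex j ∧ D p ≠ 0 := by
    by_cases hp : D p = 0
    · have hpj : p = j := by
        by_contra hne
        have := congrFun hE p
        simp [hp, hne] at this
      subst hpj
      obtain ⟨q, hq⟩ := Function.ne_iff.1 hD0
      exact ⟨q, q, by rw [add_right_cancel hE], hq⟩
    · exact ⟨p, j, hE, hp⟩
  obtain ⟨D₀, rfl⟩ : ∃ D₀, D = D₀ + unitIndex p := ⟨_, (sub_single_add_single hp).symm⟩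
  have hE : E = D₀ + unitIndex j := by
    have : E + unitIndex p = D₀ + unitIndex j + unitIndex p := by
      rw [hE, add_right_comm]
    exact add_right_cancel this
  -- After row p of the first hafnian is matched with m, the second hafnian is expanded along that
  -- same m, which brings the pair back to the induction hypothesis.
  have key : ∀ m, D₀ m ≠ 0 → H (D₀ - unitIndex m) * H E ≤
      permBound x D₀ (E - unitIndex m) := by
    intro m hm
    obtain ⟨D', rfl⟩ : ∃ D', D₀ = D' + unitIndex m := ⟨_, (sub_single_add_single hm).symm⟩
    have hE' : E = (D' + unitIndex j) + unitIndex m := by rw [hE, add_right_comm]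
    rw [hE', add_tsub_cancel_right, add_tsub_cancel_right, hrec, mul_sum]
    refine le_trans (sum_le_sum fun q _ => ?_) (permBound_step hx hB hBx D' (D' + unitIndex j) m)
    by_cases hq : (D' + unitIndex j : Fin N → ℕ) q = 0
    · simp [hq]
    · have h := ih (∑ i, D' i) (by rw [← hD, sum_add_single, sum_add_single]; omega) D'
        (D' + unitIndex j - unitIndex q) q j rfl (sub_single_add_single hq)
      rw [mul_left_comm]
      exact mul_le_mul_of_nonneg_left h (mul_nonneg (hB m q) (Nat.cast_nonneg _))
  rw [hrec, sum_mul]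
  refine le_trans (sum_le_sum fun m _ => ?_) (permBound_step hx hB hBx D₀ E p)
  have hle : (D₀ m : ℝ) ≤ E m := by rw [hE]; simp
  by_cases hm : D₀ m = 0
  · rw [hm]
    simp only [Nat.cast_zero, mul_zero, zero_mul]
    refine mul_nonneg (mul_nonneg (hB p m) (Nat.cast_nonneg _)) ?_
    refine mul_nonneg (multiFactorial_pos _).le (div_nonneg ?_ ?_) <;>
      exact prod_nonneg fun i _ => pow_nonneg (hx i).le _
  · rw [mul_assoc (B p m * _)]
    refine le_trans (mul_le_mul_of_nonneg_left (key m hm)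
      (mul_nonneg (hB p m) (Nat.cast_nonneg _))) ?_
    refine mul_le_mul_of_nonneg_right (mul_le_mul_of_nonneg_left hle (hB p m)) ?_
    refine mul_nonneg (multiFactorial_pos _).le (div_nonneg ?_ ?_) <;>
      exact prod_nonneg fun i _ => pow_nonneg (hx i).le _

end Recursion

/-! ### Matrices in `𝓑` -/

section MatrixSpace

variable {N : ℕ} {B : Matrix (Fin N) (Fin N) ℝ}

theorem bMin_le (B : Matrix (Fin N) (Fin N) ℝ) (i j : Fin N) : bMin B ≤ B i j :=
  ciInf_le (f := fun p : Fin N × Fin N => B p.1 p.2) (Set.finite_range _).bddBelow (i, j)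

theorem le_bMax (B : Matrix (Fin N) (Fin N) ℝ) (i j : Fin N) : B i j ≤ bMax B :=
  (le_abs_self _).trans <|
    le_ciSup (f := fun p : Fin N × Fin N => |B p.1 p.2|) (Set.finite_range _).bddAbove (i, j)

theorem lt_bMin (hN : 1 ≤ N) {c : ℝ} (h : ∀ i j, c < B i j) : c < bMin B := by
  have : Nonempty (Fin N) := ⟨⟨0, hN⟩⟩
  obtain ⟨p, hp⟩ := exists_eq_ciInf_of_finite (f := fun p : Fin N × Fin N => B p.1 p.2)
  rw [bMin, ← hp]
  exact h _ _

theorem bMax_lt (hN : 1 ≤ N) {c : ℝ} (h0 : ∀ i j, 0 < B i j) (h : ∀ i j, B i j < c) :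
    bMax B < c := by
  have : Nonempty (Fin N) := ⟨⟨0, hN⟩⟩
  obtain ⟨p, hp⟩ := exists_eq_ciSup_of_finite (f := fun p : Fin N × Fin N => |B p.1 p.2|)
  rw [bMax, ← hp, abs_of_pos (h0 _ _)]
  exact h _ _

theorem bMin_pos (hN : 1 ≤ N) (hB : B ∈ matrixSpace N) : 0 < bMin B := lt_bMin hN hB.1

theorem bMin_le_bMax (hN : 1 ≤ N) : bMin B ≤ bMax B :=
  (bMin_le B ⟨0, hN⟩ ⟨0, hN⟩).trans (le_bMax B _ _)

theorem one_sub_posSemidef (hB : B ∈ matrixSpace N) : (1 - B).PosSemidef := by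
  have hH : (1 - B).IsHermitian := by
    have : B.IsHermitian := by
      rw [Matrix.IsHermitian, Matrix.conjTranspose_eq_transpose_of_trivial]
      exact hB.2.1
    exact Matrix.isHermitian_one.sub this
  rw [hH.posSemidef_iff_eigenvalues_nonneg]
  intro i
  have h := hH.eigenvalues_mem_spectrum_real i
  rw [spectrum.mem_iff] at h
  have h' : 1 - hH.eigenvalues i ∈ spectrum ℝ B := by
    rw [spectrum.mem_iff]
    intro hu
    apply h
    convert hu.neg using 1
    rw [map_sub, map_one]
    abel
  have := (hB.2.2 _ h').2
  simp only [Pi.zero_apply]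
  linarith

/-- There is a positive vector that `B` does not increase. -/
theorem exists_mulVec_le (hB : B ∈ matrixSpace N) :
    ∃ x : Fin N → ℝ, (∀ i, 0 < x i) ∧ ∀ i, ∑ j, B i j * x j ≤ x i := by
  have h1 : (1 : ℝ) ∉ spectrum ℝ B := fun h => lt_irrefl _ (hB.2.2 1 h).2
  rw [spectrum.notMem_iff, map_one] at h1
  obtain ⟨x, hx⟩ : ∃ x : Fin N → ℝ, (1 - B).mulVec x = 1 := by
    refine ⟨(1 - B)⁻¹.mulVec 1, ?_⟩
    rw [Matrix.mulVec_mulVec, Matrix.mul_nonsing_inv _ ((Matrix.isUnit_iff_isUnit_det _).1 h1),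
      Matrix.one_mulVec]
  have hx' : ∀ i, x i = 1 + ∑ j, B i j * x j := fun i => by
    have := congrFun hx i
    rw [Matrix.sub_mulVec, Matrix.one_mulVec] at this
    simp only [Pi.sub_apply, Matrix.mulVec, dotProduct, Pi.one_apply] at this
    linarith
  -- Maximum principle: pair x = 1 + Bx with the negative part w of x. Since x ≥ -w and `B` has
  -- positive entries, Σ w ≤ w·Bw - w·w, which is at most 0 because 1 - B is positive semidefinite.
  have hnn : ∀ i, 0 ≤ x i := by
    let w : Fin N → ℝ := fun i => max (-x i) 0
    have hw : ∀ i, 0 ≤ w i := fun i => le_max_right _ _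
    have hxw : ∀ i, -w i ≤ x i := fun i => by
      have := le_max_left (-x i) 0
      simp only [w]; linarith
    have hww : ∀ i, w i * x i = -(w i * w i) := fun i => by
      by_cases h : x i ≤ 0
      · have : w i = -x i := max_eq_left (by linarith)
        rw [this]; ring
      · have : w i = 0 := max_eq_right (by linarith)
        rw [this]; ring
    have hq := (one_sub_posSemidef hB).dotProduct_mulVec_nonneg w
    have hq' : ∑ i, w i * ∑ j, B i j * w j ≤ ∑ i, w i * w i := by
      rw [Matrix.sub_mulVec, Matrix.one_mulVec, dotProduct_sub] at hq
      simpa [Matrix.mulVec, dotProduct] using hq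
    have hsum : ∑ i, w i * x i = ∑ i, w i + ∑ i, w i * ∑ j, B i j * x j := by
      rw [← sum_add_distrib]
      refine sum_congr rfl fun i _ => ?_
      rw [← mul_one_add, ← hx' i]
    have hge : -∑ i, w i * ∑ j, B i j * w j ≤ ∑ i, w i * ∑ j, B i j * x j := by
      rw [← sum_neg_distrib]
      refine sum_le_sum fun i _ => ?_
      rw [← mul_neg, ← sum_neg_distrib]
      refine mul_le_mul_of_nonneg_left (sum_le_sum fun j _ => ?_) (hw i)
      rw [← mul_neg]
      exact mul_le_mul_of_nonneg_left (hxw j) (hB.1 i j).le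
    rw [sum_congr rfl fun i _ => hww i, sum_neg_distrib] at hsum
    have hz : ∑ i, w i = 0 := le_antisymm (by linarith) (sum_nonneg fun i _ => hw i)
    intro i
    have := (sum_eq_zero_iff_of_nonneg fun i _ => hw i).1 hz i (mem_univ i)
    have := hxw i
    linarith
  refine ⟨x, fun i => ?_, fun i => ?_⟩
  · rw [hx' i]
    have : 0 ≤ ∑ j, B i j * x j := sum_nonneg fun j _ => mul_nonneg (hB.1 i j).le (hnn j)
    linarith
  · have := hx' i
    linarith

/-- On the diagonal D = E = I the powers of x in `permBound` cancel. -/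
theorem hafRep_sq_le (hB : B ∈ matrixSpace N) (I : Fin N → ℕ) :
    hafRep B I ^ 2 ≤ multiFactorial I := by
  by_cases hI : I = 0
  · subst hI; simp [multiFactorial]
  · obtain ⟨p, -⟩ := Function.ne_iff.1 hI
    obtain ⟨x, hx, hBx⟩ := exists_mulVec_le hB
    have h := mul_le_permBound hx (fun i j => (hB.1 i j).le) hBx (hafRep_zero B)
      (hafRep_add_single hB.2.1) _ I I p p rfl rfl
    rw [permBound, div_self, mul_one] at h
    · rwa [pow_two]
    · exact (prod_pos fun i _ => pow_pos (hx i) _).ne'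

/-- `(2k - 1)!! = (2k)! / (2^k k!)`. -/
def oddFactorial (k : ℕ) : ℝ := ((2 * k)! : ℝ) / (2 ^ k * k !)

theorem oddFactorial_pos (k : ℕ) : 0 < oddFactorial k := by
  unfold oddFactorial; positivity

theorem hafRep_le {b : ℝ} {k : ℕ} (h0 : ∀ i j, 0 ≤ B i j) (hb : ∀ i j, B i j ≤ b)
    (I : Fin N → ℕ) (hI : ∑ i, I i = 2 * k) : hafRep B I ≤ b ^ k * oddFactorial k := by
  rw [hafRep, hafnian_eq (hI.trans (mul_comm _ _)), oddFactorial,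
    show ((2 * k)! : ℝ) = ((∑ i, I i)! : ℝ) by rw [hI]]
  calc _ ≤ 1 / ((k ! : ℝ) * 2 ^ k) * ∑ σ : Equiv.Perm (Fin (∑ i, I i)), ∏ j : Fin k, b := by
        gcongr
        · exact fun _ _ => h0 _ _
        · exact hb _ _
    _ = _ := by
        simp only [prod_const, sum_const, card_univ, Fintype.card_perm, Fintype.card_fin,
          nsmul_eq_mul]
        field_simp

theorem le_hafRep {b : ℝ} {k : ℕ} (hb0 : 0 ≤ b) (hb : ∀ i j, b ≤ B i j)
    (I : Fin N → ℕ) (hI : ∑ i, I i = 2 * k) : b ^ k * oddFactorial k ≤ hafRep B I := by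
  rw [hafRep, hafnian_eq (hI.trans (mul_comm _ _)), oddFactorial,
    show ((2 * k)! : ℝ) = ((∑ i, I i)! : ℝ) by rw [hI]]
  calc _ = 1 / ((k ! : ℝ) * 2 ^ k) * ∑ σ : Equiv.Perm (Fin (∑ i, I i)), ∏ j : Fin k, b := by
        simp only [prod_const, sum_const, card_univ, Fintype.card_perm, Fintype.card_fin,
          nsmul_eq_mul]
        field_simp
    _ ≤ _ := by
        gcongr
        exact hb _ _

theorem hafRep_pos (hN : 1 ≤ N) (hB : B ∈ matrixSpace N) {k : ℕ} (I : Idx N k) :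
    0 < hafRep B I.1 :=
  lt_of_lt_of_le (mul_pos (pow_pos (bMin_pos hN hB) _) (oddFactorial_pos _))
    (le_hafRep (bMin_pos hN hB).le (bMin_le B) I.1 I.2)

/-! ### The constant `d` -/

theorem pow_card_le_prod_of_forall_le {c : ℝ} (hc : 0 ≤ c) (s : Multiset ℝ)
    (h : ∀ x ∈ s, c ≤ x) : c ^ s.card ≤ s.prod := by
  induction s using Multiset.induction_on with
  | empty => simp
  | cons a s ih =>
    rw [Multiset.card_cons, Multiset.prod_cons, pow_succ']
    exact mul_le_mul (h a (Multiset.mem_cons_self a s))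
      (ih fun x hx => h x (Multiset.mem_cons_of_mem hx)) (pow_nonneg hc _)
      (hc.trans (h a (Multiset.mem_cons_self a s)))

theorem prod_le_one_of_forall_le (s : Multiset ℝ) (h0 : ∀ x ∈ s, 0 ≤ x) (h : ∀ x ∈ s, x ≤ 1) :
    s.prod ≤ 1 := by
  induction s using Multiset.induction_on with
  | empty => simp
  | cons a s ih =>
    rw [Multiset.prod_cons]
    exact mul_le_one₀ (h a (Multiset.mem_cons_self a s))
      (Multiset.prod_nonneg fun x hx => h0 x (Multiset.mem_cons_of_mem hx))
      (ih (fun x hx => h0 x (Multiset.mem_cons_of_mem hx))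
        fun x hx => h x (Multiset.mem_cons_of_mem hx))

theorem mem_spectrum_of_mem_roots {l : ℝ} (hl : l ∈ B.charpoly.roots) : l ∈ spectrum ℝ B :=
  Matrix.mem_spectrum_iff_isRoot_charpoly.2 (Polynomial.isRoot_of_mem_roots hl)

theorem dConst_pos (hB : B ∈ matrixSpace N) : 0 < dConst B := by
  refine Multiset.prod_pos fun x hx => ?_
  obtain ⟨l, hl, rfl⟩ := Multiset.mem_map.1 hx
  obtain ⟨h0, h1⟩ := hB.2.2 l (mem_spectrum_of_mem_roots hl)
  exact Real.sqrt_pos.2 (by nlinarith)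

theorem dConst_le_one (B : Matrix (Fin N) (Fin N) ℝ) : dConst B ≤ 1 := by
  refine prod_le_one_of_forall_le _ (fun x hx => ?_) fun x hx => ?_
  · obtain ⟨l, hl, rfl⟩ := Multiset.mem_map.1 hx
    exact Real.sqrt_nonneg _
  · obtain ⟨l, hl, rfl⟩ := Multiset.mem_map.1 hx
    exact Real.sqrt_le_one.2 (by nlinarith)

/-- Gershgorin's theorem, with the diagonal entry added back to obtain a full row sum. -/
theorem abs_le_of_mem_spectrum {c l : ℝ} (h0 : ∀ i j, 0 ≤ B i j) (hc : ∀ i j, B i j ≤ c)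
    (hl : l ∈ spectrum ℝ B) : |l| ≤ N * c := by
  have h : Module.End.HasEigenvalue (Matrix.toLin' B) l := by
    rw [Module.End.hasEigenvalue_iff_mem_spectrum, Matrix.spectrum_toLin']
    exact hl
  obtain ⟨i, hi⟩ := eigenvalue_mem_ball h
  rw [mem_closedBall_iff_norm, Real.norm_eq_abs] at hi
  calc |l| ≤ |l - B i i| + |B i i| := by
        have := abs_add_le (l - B i i) (B i i)
        rwa [sub_add_cancel] at this
    _ ≤ ∑ j ∈ univ.erase i, ‖B i j‖ + ‖B i i‖ := by gcongr; exact le_rfl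
    _ = ∑ j, ‖B i j‖ := by rw [sum_erase_add _ _ (mem_univ i)]
    _ ≤ ∑ j : Fin N, c := by
        gcongr with j
        rw [Real.norm_eq_abs, abs_of_nonneg (h0 i j)]
        exact hc i j
    _ = N * c := by simp

theorem le_dConst {c r : ℝ} (h0 : ∀ i j, 0 ≤ B i j) (hc : ∀ i j, B i j ≤ c) (hr : N * c ≤ r) :
    √(1 - r ^ 2) ^ N ≤ dConst B := by
  have hs : √(1 - r ^ 2) ≤ 1 := Real.sqrt_le_one.2 (by nlinarith)
  have hcard : (B.charpoly.roots.map fun l => √(1 - l ^ 2)).card ≤ N := by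
    rw [Multiset.card_map]
    refine (Polynomial.card_roots' _).trans ?_
    rw [Matrix.charpoly_natDegree_eq_dim, Fintype.card_fin]
  -- Only "at most N real roots" is needed here, because each factor is bounded below by a number in
  -- [0, 1].
  refine (pow_le_pow_of_le_one (Real.sqrt_nonneg _) hs hcard).trans ?_
  refine pow_card_le_prod_of_forall_le (Real.sqrt_nonneg _) _ fun x hx => ?_
  obtain ⟨l, hl, rfl⟩ := Multiset.mem_map.1 hx
  refine Real.sqrt_le_sqrt ?_
  have h := (abs_le_of_mem_spectrum h0 hc (mem_spectrum_of_mem_roots hl)).trans hr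
  have := sq_le_sq' (by linarith [abs_nonneg l]) h
  rw [sq_abs] at this
  linarith

end MatrixSpace

/-! ### Numerical and factorial estimates -/

theorem eConst_pos : 0 < eConst := Real.exp_pos _

/-- This makes e^{1/25-1/6}/√π smaller than 1/2, the value of √n · binom(2n,n)/4^n at n = 1. The
exponent is -19/150. -/
theorem eConst_lt : eConst < √Real.pi / 2 := by
  have h1 : eConst * Real.exp (19 / 150) = 1 := by
    rw [eConst, ← Real.exp_add]; norm_num
  have h2 := Real.quadratic_le_exp_of_nonneg (x := 19 / 150) (by norm_num)
  have h3 : (1.77 : ℝ) < √Real.pi := by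
    rw [Real.lt_sqrt (by norm_num)]
    have := Real.pi_gt_d2
    norm_num at this ⊢
    linarith
  have h4 := eConst_pos
  nlinarith

/-- `binom(2n, n) / 4^n`. -/
def centralRatio (n : ℕ) : ℝ := ((2 * n)! : ℝ) / (4 ^ n * (n ! : ℝ) ^ 2)

theorem centralRatio_pos (n : ℕ) : 0 < centralRatio n := by
  unfold centralRatio; positivity

@[simp] theorem centralRatio_zero : centralRatio 0 = 1 := by simp [centralRatio]

theorem centralRatio_one : centralRatio 1 = 1 / 2 := by norm_num [centralRatio]

theorem oddFactorial_eq (n : ℕ) : oddFactorial n = centralRatio n * 2 ^ n * n ! := by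
  have : (4 : ℝ) ^ n = 2 ^ n * 2 ^ n := by rw [← mul_pow]; norm_num
  rw [oddFactorial, centralRatio, this]
  have : (n ! : ℝ) ≠ 0 := by positivity
  field_simp

theorem centralRatio_succ (n : ℕ) :
    centralRatio (n + 1) = centralRatio n * ((2 * n + 1) / (2 * n + 2)) := by
  rw [centralRatio, centralRatio, show 2 * (n + 1) = 2 * n + 1 + 1 by ring, Nat.factorial_succ,
    Nat.factorial_succ, Nat.factorial_succ, pow_succ]
  have : (n ! : ℝ) ≠ 0 := by positivity
  push_cast
  field_simp
  ring

theorem centralRatio_le_one (n : ℕ) : centralRatio n ≤ 1 := by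
  induction n with
  | zero => simp
  | succ n ih =>
    rw [centralRatio_succ]
    refine mul_le_one₀ ih (by positivity) ?_
    rw [div_le_one (by positivity)]
    linarith

/-- The right side is nondecreasing in n and equals 1/4 at n = 1. -/
theorem le_mul_centralRatio_sq (n : ℕ) (hn : 1 ≤ n) : 1 / 4 ≤ n * centralRatio n ^ 2 := by
  induction n, hn using Nat.le_induction with
  | base => norm_num [centralRatio_one]
  | succ n hn ih =>
    refine ih.trans ?_
    rw [centralRatio_succ, mul_pow, div_pow]
    have h : (n : ℝ) ≤ (n + 1 : ℕ) * ((2 * n + 1) ^ 2 / (2 * n + 2) ^ 2) := by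
      rw [← mul_div_assoc, le_div_iff₀ (by positivity)]
      push_cast
      nlinarith [(Nat.cast_nonneg n : (0 : ℝ) ≤ n)]
    calc (n : ℝ) * centralRatio n ^ 2
        ≤ ((n + 1 : ℕ) * ((2 * n + 1) ^ 2 / (2 * n + 2) ^ 2)) * centralRatio n ^ 2 := by gcongr
      _ = _ := by ring

/-- The Wallis product W_n is 1/((2n+1) c_n²), where c_n is the central ratio, so the known lower
bound for W_n is an upper bound for c_n; then (2n+1)² ≥ 4n(n+1). -/
theorem mul_centralRatio_sq_le (n : ℕ) : n * centralRatio n ^ 2 ≤ 1 / Real.pi := by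
  have h := Real.Wallis.le_W n
  have hW : Real.Wallis.W n = 1 / (centralRatio n ^ 2 * (2 * n + 1)) := by
    rw [Real.Wallis.W_eq_factorial_ratio, centralRatio, pow_mul]
    have h1 : (n ! : ℝ) ≠ 0 := by positivity
    have h2 : ((2 * n)! : ℝ) ≠ 0 := by positivity
    have h3 : ((2 : ℝ) ^ 4) ^ n = (4 ^ n) ^ 2 := by
      rw [← pow_mul (4 : ℝ), mul_comm n 2, pow_mul]
      norm_num
    rw [h3]
    field_simp
  have hc := centralRatio_pos n
  rw [hW, le_div_iff₀ (by positivity)] at h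
  rw [le_div_iff₀ Real.pi_pos]
  have hn : (0 : ℝ) ≤ n := Nat.cast_nonneg n
  have h' : centralRatio n ^ 2 * Real.pi * (2 * n + 1) ^ 2 ≤ 4 * (n + 1) := by
    have : (2 * (n : ℝ) + 1) / (2 * n + 2) * (Real.pi / 2) * (centralRatio n ^ 2 * (2 * n + 1)) =
        centralRatio n ^ 2 * Real.pi * (2 * n + 1) ^ 2 / (4 * (n + 1)) := by
      field_simp
      ring
    rw [this, div_le_one (by positivity)] at h
    exact h
  have h'' : centralRatio n ^ 2 * Real.pi * (4 * n * (n + 1)) ≤ 4 * (n + 1) := by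
    refine le_trans ?_ h'
    have : 0 ≤ centralRatio n ^ 2 * Real.pi := by have := Real.pi_pos; positivity
    nlinarith
  nlinarith

theorem eConst_div_lt_centralRatio {n : ℕ} (hn : 1 ≤ n) :
    1 / √Real.pi * eConst / √n < centralRatio n := by
  have hn' : (0 : ℝ) < n := by exact_mod_cast hn
  have hπ := Real.sqrt_pos.2 Real.pi_pos
  have h1 : 1 / √Real.pi * eConst / √n < 1 / 2 / √n := by
    have : 0 < √(n : ℝ) := Real.sqrt_pos.2 hn'
    gcongr
    rw [one_div, inv_mul_lt_iff₀ hπ]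
    linarith [eConst_lt]
  refine h1.trans_le ?_
  rw [div_le_iff₀ (Real.sqrt_pos.2 hn')]
  refine le_of_sq_le_sq ?_ (mul_nonneg (centralRatio_pos n).le (Real.sqrt_nonneg _))
  rw [mul_pow, Real.sq_sqrt hn'.le]
  have := le_mul_centralRatio_sq n hn
  nlinarith

theorem centralRatio_le {n : ℕ} (hn : 1 ≤ n) : centralRatio n ≤ 1 / √Real.pi / √n := by
  have hn' : (0 : ℝ) < n := by exact_mod_cast hn
  rw [le_div_iff₀ (Real.sqrt_pos.2 hn')]
  refine le_of_sq_le_sq ?_ (by positivity)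
  rw [mul_pow, Real.sq_sqrt hn'.le, div_pow, Real.sq_sqrt Real.pi_pos.le]
  have := mul_centralRatio_sq_le n
  nlinarith

/-- The Stirling ratio decreases, so s = 1 is the worst case; there the claim becomes e^{11} ≤
(2π)^6, checked numerically. -/
theorem factorial_le_stirling {s : ℕ} (hs : 1 ≤ s) :
    (s ! : ℝ) ≤ √(2 * Real.pi * s) * (s / Real.exp 1) ^ s * Real.exp (1 / 12) := by
  have h1 : Stirling.stirlingSeq s ≤ Stirling.stirlingSeq 1 := by
    have := Stirling.stirlingSeq'_antitone (Nat.zero_le (s - 1))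
    simpa [Nat.succ_eq_add_one, Nat.sub_add_cancel hs] using this
  have h2 : Stirling.stirlingSeq 1 ≤ √Real.pi * Real.exp (1 / 12) := by
    rw [Stirling.stirlingSeq_one, div_le_iff₀ (by positivity)]
    have hexp : Real.exp 1 = Real.exp (11 / 12) * Real.exp (1 / 12) := by
      rw [← Real.exp_add]; norm_num
    have h3 : Real.exp (11 / 12) ≤ √(2 * Real.pi) := by
      refine Real.le_sqrt_of_sq_le ?_
      rw [← Real.exp_nat_mul]
      refine le_of_pow_le_pow_left₀ (n := 6) (by norm_num) (by positivity) ?_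
      rw [← Real.exp_nat_mul]
      have h4 : Real.exp ((6 : ℕ) * ((2 : ℕ) * (11 / 12))) = Real.exp 1 ^ 11 := by
        rw [← Real.exp_nat_mul]; norm_num
      rw [h4]
      calc Real.exp 1 ^ 11 ≤ 2.7182818286 ^ 11 := by
            gcongr
            exact Real.exp_one_lt_d9.le
        _ ≤ (2 * 3.14) ^ 6 := by norm_num
        _ ≤ (2 * Real.pi) ^ 6 := by
            gcongr
            exact Real.pi_gt_d2.le
    rw [hexp]
    calc Real.exp (11 / 12) * Real.exp (1 / 12) ≤ √(2 * Real.pi) * Real.exp (1 / 12) := by gcongr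
      _ = √Real.pi * Real.exp (1 / 12) * √2 := by
        rw [Real.sqrt_mul (by norm_num)]; ring
  have h := h1.trans h2
  have hs' : (0 : ℝ) < s := by exact_mod_cast hs
  rw [Stirling.stirlingSeq, div_le_iff₀ (by positivity)] at h
  refine h.trans (le_of_eq ?_)
  rw [show 2 * Real.pi * s = Real.pi * (2 * s) by ring, Real.sqrt_mul Real.pi_pos.le]
  ring

/-! ### Polylogarithms and sums over levels -/

/-- The summand of the truncated polylogarithm. -/
def polylogTerm (s : ℝ) (K : ℕ∞) (z : ℝ) (k : ℕ) : ℝ :=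
  if 1 ≤ k ∧ (k : ℕ∞) ≤ K then z ^ k / (k : ℝ) ^ s else 0

theorem polylog_eq_tsum (s : ℝ) (K : ℕ∞) (z : ℝ) : polylog s K z = ∑' k, polylogTerm s K z k := by
  unfold polylog polylogTerm
  refine tsum_congr fun k => ?_
  congr

theorem polylogTerm_of_le {s : ℝ} {K : ℕ∞} {z : ℝ} {k : ℕ} (h1 : 1 ≤ k) (hK : (k : ℕ∞) ≤ K) :
    polylogTerm s K z k = z ^ k / (k : ℝ) ^ s := if_pos ⟨h1, hK⟩

theorem polylogTerm_nonneg (s : ℝ) (K : ℕ∞) {z : ℝ} (hz : 0 ≤ z) (k : ℕ) :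
    0 ≤ polylogTerm s K z k := by
  unfold polylogTerm
  split_ifs
  · positivity
  · exact le_rfl

theorem summable_polylogTerm {s : ℝ} {K : ℕ∞} {z : ℝ} (hz : 0 ≤ z) (h : K = ⊤ → z < 1) :
    Summable (polylogTerm s K z) := by
  by_cases hK : K = ⊤
  -- An integer exponent above -s gives domination by a polynomial times a geometric sequence,
  -- whatever the sign of s.
  · have hs := summable_pow_mul_geometric_of_norm_lt_one (R := ℝ) ⌈|s|⌉₊ (r := z)
      (by rw [Real.norm_eq_abs, abs_of_nonneg hz]; exact h hK)
    refine Summable.of_nonneg_of_le (polylogTerm_nonneg s K hz) (fun k => ?_) hs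
    unfold polylogTerm
    split_ifs with hk
    · have hk1 : (1 : ℝ) ≤ k := by exact_mod_cast hk.1
      rw [div_eq_inv_mul, ← Real.rpow_neg (by positivity), ← Real.rpow_natCast (k : ℝ) ⌈|s|⌉₊]
      gcongr
      · exact (neg_le_abs s).trans (Nat.le_ceil _)
    · positivity
  · obtain ⟨n, rfl⟩ := ENat.ne_top_iff_exists.1 hK
    refine summable_of_ne_finset_zero (s := range (n + 1)) fun k hk => if_neg ?_
    rintro ⟨-, h'⟩
    rw [Nat.cast_le] at h'
    exact hk (mem_range.2 (by omega))

theorem polylog_nonneg (s : ℝ) (K : ℕ∞) {z : ℝ} (hz : 0 ≤ z) : 0 ≤ polylog s K z := by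
  rw [polylog_eq_tsum]
  exact tsum_nonneg (polylogTerm_nonneg s K hz)

theorem polylog_mono {s : ℝ} {K K' : ℕ∞} {z z' : ℝ} (hK : K ≤ K') (hz : 0 ≤ z) (hzz : z ≤ z')
    (h : K' = ⊤ → z' < 1) : polylog s K z ≤ polylog s K' z' := by
  have hz' := hz.trans hzz
  have hle : ∀ k, polylogTerm s K z k ≤ polylogTerm s K' z' k := fun k => by
    by_cases hk : 1 ≤ k ∧ (k : ℕ∞) ≤ K
    · rw [polylogTerm_of_le hk.1 hk.2, polylogTerm_of_le hk.1 (hk.2.trans hK)]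
      gcongr
    · rw [polylogTerm, if_neg hk]
      exact polylogTerm_nonneg _ _ hz' _
  rw [polylog_eq_tsum, polylog_eq_tsum]
  have hs := summable_polylogTerm (s := s) hz' h
  exact (hs.of_nonneg_of_le (polylogTerm_nonneg _ _ hz) hle).tsum_le_tsum hle hs

variable {K : ℕ∞}

theorem hasSum_level_of_hasSum {g : ℕ → ℝ} {x : ℝ}
    (h : HasSum (fun k : ℕ => if (k : ℕ∞) ≤ K then g k else 0) x) :
    HasSum (fun k : Level K => g k.1) x := by
  have := hasSum_subtype_iff_indicator (f := g) (s := {k : ℕ | (k : ℕ∞) ≤ K}) (a := x)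
  refine this.2 ?_
  convert h using 1
  funext k
  by_cases hk : (k : ℕ∞) ≤ K <;> simp [Set.indicator, hk]

theorem hasSum_nat_one_add_polylog {s z : ℝ} (c : ℝ) (hz : 0 ≤ z) (h : K = ⊤ → z < 1) :
    HasSum (fun k : ℕ => (if k = 0 then 1 else 0) + c * polylogTerm s K z k)
      (1 + c * polylog s K z) := by
  rw [polylog_eq_tsum]
  exact HasSum.add (hasSum_ite_eq _ _) ((summable_polylogTerm hz h).hasSum.mul_left c)

theorem hasSum_one_add_polylog {s z : ℝ} (c : ℝ) (hz : 0 ≤ z) (h : K = ⊤ → z < 1) :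
    HasSum (fun k : Level K => if k.1 = 0 then 1 else c * (z ^ k.1 / (k.1 : ℝ) ^ s))
      (1 + c * polylog s K z) := by
  refine hasSum_level_of_hasSum (g := fun k => if k = 0 then 1 else c * (z ^ k / (k : ℝ) ^ s)) ?_
  convert hasSum_nat_one_add_polylog c hz h using 1
  funext k
  by_cases hk0 : k = 0
  · simp [hk0, polylogTerm]
  · by_cases hk : (k : ℕ∞) ≤ K
    · rw [polylogTerm_of_le (Nat.one_le_iff_ne_zero.2 hk0) hk]
      simp [hk0, hk]
    · simp [hk0, hk, polylogTerm]

/-! ### The function `G` -/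

theorem two_mul_eq {N k : ℕ} : 2 * k = N * sIdx N k + rIdx N k := by
  have : N * sIdx N k ≤ 2 * k := by
    unfold sIdx
    have := Nat.mul_div_le (2 * k - 1) N
    omega
  unfold rIdx
  omega

theorem rIdx_pos {N k : ℕ} (hk : 1 ≤ k) : 1 ≤ rIdx N k := by
  unfold rIdx sIdx
  have := Nat.mul_div_le (2 * k - 1) N
  omega

theorem rIdx_le {N k : ℕ} (hN : 1 ≤ N) : rIdx N k ≤ N := by
  unfold rIdx sIdx
  have := Nat.lt_mul_div_succ (2 * k - 1) hN
  rw [Nat.mul_succ] at this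
  omega

theorem sIdx_mono (N : ℕ) : Monotone (sIdx N) := fun a b h =>
  Nat.div_le_div_right (by omega)

theorem sIdx_le_sTop {N k : ℕ} (hk : (k : ℕ∞) ≤ K) : (sIdx N k : ℕ∞) ≤ sTop N K := by
  unfold sTop
  induction K using ENat.recTopCoe with
  | top => exact le_top
  | coe n =>
    rw [ENat.map_natCast]
    exact Nat.cast_le.2 (sIdx_mono N (Nat.cast_le.1 hk))

/-- The constant in the definition of `G`. -/
def gConst (q : ℝ) (N : ℕ) : ℝ :=
  (2 : ℝ) ^ (-min q 0) * (2 * Real.pi) ^ (((N : ℝ) - 1) / 2) * (N : ℝ) ^ (q - 1 / 2) *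
    Real.exp ((N : ℝ) / 12)

theorem gConst_nonneg (q : ℝ) (N : ℕ) : 0 ≤ gConst q N := by
  have := Real.pi_pos
  unfold gConst; positivity

theorem rpow_le_of_le_of_le {q x y : ℝ} (hy : 0 < y) (h1 : y / 2 ≤ x) (h2 : x ≤ y) :
    x ^ q ≤ (2 : ℝ) ^ (-min q 0) * y ^ q := by
  rcases le_total 0 q with hq | hq
  · rw [min_eq_right hq]
    simp only [neg_zero, Real.rpow_zero, one_mul]
    exact Real.rpow_le_rpow (by linarith) h2 hq
  · rw [min_eq_left hq, Real.rpow_neg (by norm_num), inv_mul_eq_div,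
      ← Real.div_rpow hy.le (by norm_num)]
    exact Real.rpow_le_rpow_of_nonpos (by linarith) h1 hq

/-- Stirling from above for s! and from below for (Ns)!, together with (Ns+r)! ≥ (Ns)! (Ns)^r and s
+ 1 ≤ 2s. The powers of e cancel, leaving N^{-Ns}. -/
theorem factorial_pow_div_factorial_le {N s r : ℕ} (hN : 1 ≤ N) (hs : 1 ≤ s) :
    (s ! : ℝ) ^ N * ((s : ℝ) + 1) ^ r / ((N * s + r)! : ℝ) ≤
      (2 * Real.pi) ^ (((N : ℝ) - 1) / 2) * (N : ℝ) ^ (-(1 / 2) : ℝ) * Real.exp ((N : ℝ) / 12) *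
        (s : ℝ) ^ (((N : ℝ) - 1) / 2) * (2 / N) ^ r * ((1 / (N : ℝ) ^ N) ^ s) := by
  have hs' : (1 : ℝ) ≤ s := by exact_mod_cast hs
  have hs0 : (0 : ℝ) < s := by linarith
  have hN' : (0 : ℝ) < N := by exact_mod_cast hN
  have hπ := Real.pi_pos
  have h1 : (s ! : ℝ) ^ N ≤
      (√(2 * Real.pi * s) * (s / Real.exp 1) ^ s * Real.exp (1 / 12)) ^ N :=
    pow_le_pow_left₀ (by positivity) (factorial_le_stirling hs) N
  have h2 : ((s : ℝ) + 1) ^ r ≤ (2 * s) ^ r := by gcongr; linarith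
  have h3 : √(2 * Real.pi * (N * s : ℕ)) * ((N * s : ℕ) / Real.exp 1) ^ (N * s) * (N * s : ℝ) ^ r ≤
      ((N * s + r)! : ℝ) := by
    calc _ ≤ ((N * s)! : ℝ) * ((N * s : ℝ) + 1) ^ r := by
          gcongr
          · exact Stirling.le_factorial_stirling _
          · linarith
      _ ≤ _ := by exact_mod_cast Nat.factorial_mul_pow_le_factorial
  have hsq : √(2 * Real.pi * s) ^ N / √(2 * Real.pi * (N * s : ℕ)) =
      (2 * Real.pi) ^ (((N : ℝ) - 1) / 2) * (N : ℝ) ^ (-(1 / 2) : ℝ) *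
        (s : ℝ) ^ (((N : ℝ) - 1) / 2) := by
    have e1 : √(2 * Real.pi * (N * s : ℕ)) = √(2 * Real.pi * s) * √N := by
      rw [← Real.sqrt_mul (by positivity)]
      push_cast
      congr 1; ring
    have e2 : √(2 * Real.pi * s) ^ N =
        √(2 * Real.pi * s) * (2 * Real.pi * s) ^ (((N : ℝ) - 1) / 2) := by
      rw [Real.sqrt_eq_rpow, ← Real.rpow_natCast, ← Real.rpow_mul (by positivity),
        ← Real.rpow_add (by positivity)]
      congr 1; ring
    rw [e1, e2, Real.mul_rpow (by positivity) hs0.le, Real.rpow_neg hN'.le,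
      ← Real.sqrt_eq_rpow]
    have : √(2 * Real.pi * s) ≠ 0 := by positivity
    have : √(N : ℝ) ≠ 0 := by positivity
    field_simp
  calc (s ! : ℝ) ^ N * ((s : ℝ) + 1) ^ r / ((N * s + r)! : ℝ)
      ≤ (√(2 * Real.pi * s) * (s / Real.exp 1) ^ s * Real.exp (1 / 12)) ^ N * (2 * s) ^ r /
        (√(2 * Real.pi * (N * s : ℕ)) * ((N * s : ℕ) / Real.exp 1) ^ (N * s) *
          (N * s : ℝ) ^ r) := by gcongr
    _ = √(2 * Real.pi * s) ^ N / √(2 * Real.pi * (N * s : ℕ)) * Real.exp ((N : ℝ) / 12) *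
          (2 / N) ^ r * ((1 / (N : ℝ) ^ N) ^ s) := by
        have e1 : Real.exp ((N : ℝ) / 12) = Real.exp (1 / 12) ^ N := by
          rw [← Real.exp_nat_mul]; congr 1; ring
        rw [e1, mul_pow, mul_pow, mul_pow, mul_pow, div_pow, div_pow, div_pow, div_pow]
        push_cast
        rw [mul_pow, ← pow_mul, ← pow_mul, one_div (_ ^ N), inv_pow, ← pow_mul, mul_comm s N]
        have : √(2 * Real.pi * (N * s)) ≠ 0 := by positivity
        field_simp
    _ = _ := by rw [hsq]; ring

/-- If 2k ≤ N then s_k = 0, where the Stirling estimate does not apply, and the term is kept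
exactly. Otherwise r_k ≤ N ≤ N s_k, so k lies between N s_k/2 and N s_k; this is the source of the
factor 2^{-q^-}. -/
theorem gFun_term_le {N k : ℕ} (hN : 1 ≤ N) (hk : 1 ≤ k) (hkK : (k : ℕ∞) ≤ K) {q z : ℝ}
    (hz : 0 ≤ z) :
    (k : ℝ) ^ q * mIdx N k * z ^ (2 * k) / ((2 * k)! : ℝ) ≤
      (if k ∈ Icc 1 (N / 2) then (k : ℝ) ^ q / ((2 * k)! : ℝ) * z ^ (2 * k) else 0) +
      gConst q N * (polylogTerm 0 N (2 * z / N) (rIdx N k) *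
        polylogTerm (1 / 2 - (N : ℝ) / 2 - q) (sTop N K) (z ^ N / (N : ℝ) ^ N) (sIdx N k)) := by
  have hN' : (0 : ℝ) < N := by exact_mod_cast hN
  by_cases h : k ≤ N / 2
  · have hs : sIdx N k = 0 := Nat.div_eq_of_lt (by omega)
    rw [if_pos (mem_Icc.2 ⟨hk, h⟩), mIdx, hs]
    have : 0 ≤ gConst q N * (polylogTerm 0 N (2 * z / N) (rIdx N k) *
        polylogTerm (1 / 2 - (N : ℝ) / 2 - q) (sTop N K) (z ^ N / (N : ℝ) ^ N) 0) :=
      mul_nonneg (gConst_nonneg _ _) (mul_nonneg (polylogTerm_nonneg _ _ (by positivity) _)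
        (polylogTerm_nonneg _ _ (by positivity) _))
    refine le_trans (le_of_eq ?_) (le_add_of_nonneg_right this)
    simp
    ring
  · rw [if_neg (fun h' => h (mem_Icc.1 h').2), zero_add]
    have hr1 : 1 ≤ rIdx N k := rIdx_pos hk
    have hrN : rIdx N k ≤ N := rIdx_le hN
    have hs1 : 1 ≤ sIdx N k := (Nat.one_le_div_iff hN).2 (by omega)
    have h2k := two_mul_eq (N := N) (k := k)
    rw [polylogTerm_of_le hr1 (by exact_mod_cast hrN), polylogTerm_of_le hs1 (sIdx_le_sTop hkK),
      mIdx]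
    set s := sIdx N k
    set r := rIdx N k
    have hs0 : (0 : ℝ) < s := by exact_mod_cast hs1
    have hNs : r ≤ N * s := hrN.trans (Nat.le_mul_of_pos_right N hs1)
    have h2k' : (2 * k : ℝ) = N * s + r := by exact_mod_cast h2k
    have hNs' : (r : ℝ) ≤ N * s := by exact_mod_cast hNs
    have hr0 : (0 : ℝ) ≤ r := Nat.cast_nonneg r
    have hkq : (k : ℝ) ^ q ≤ (2 : ℝ) ^ (-min q 0) * ((N : ℝ) ^ q * (s : ℝ) ^ q) := by
      rw [← Real.mul_rpow hN'.le hs0.le]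
      refine rpow_le_of_le_of_le (by positivity) ?_ ?_ <;> linarith
    have hf := factorial_pow_div_factorial_le (r := r) hN hs1
    rw [← h2k] at hf
    have hπ := Real.pi_pos
    calc (k : ℝ) ^ q * ((s ! : ℝ) ^ N * ((s : ℝ) + 1) ^ r) * z ^ (2 * k) / ((2 * k)! : ℝ)
        = (k : ℝ) ^ q * ((s ! : ℝ) ^ N * ((s : ℝ) + 1) ^ r / ((2 * k)! : ℝ)) * z ^ (2 * k) := by
          ring
      _ ≤ ((2 : ℝ) ^ (-min q 0) * ((N : ℝ) ^ q * (s : ℝ) ^ q)) * ((2 * Real.pi) ^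
            (((N : ℝ) - 1) / 2) * (N : ℝ) ^ (-(1 / 2) : ℝ) * Real.exp ((N : ℝ) / 12) *
            (s : ℝ) ^ (((N : ℝ) - 1) / 2) * (2 / N) ^ r * ((1 / (N : ℝ) ^ N) ^ s)) *
            z ^ (2 * k) := by gcongr
      _ = _ := by
          have e1 : (N : ℝ) ^ (q - 1 / 2) = (N : ℝ) ^ q * (N : ℝ) ^ (-(1 / 2) : ℝ) := by
            rw [← Real.rpow_add hN']; rfl
          have e2 : ((s : ℝ) ^ (1 / 2 - (N : ℝ) / 2 - q))⁻¹ =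
              (s : ℝ) ^ q * (s : ℝ) ^ (((N : ℝ) - 1) / 2) := by
            rw [← Real.rpow_neg hs0.le, ← Real.rpow_add hs0]; congr 1; ring
          have e3 : z ^ (2 * k) = (z ^ N) ^ s * z ^ r := by rw [h2k, pow_add, pow_mul]
          rw [gConst, e1, div_eq_mul_inv (_ ^ s), e2, e3, Real.rpow_zero, div_one,
            mul_div_right_comm, mul_pow, div_eq_mul_one_div (z ^ N), mul_pow]
          ring

theorem injective_rIdx_sIdx (N : ℕ) (K : ℕ∞) :
    Function.Injective fun k : Level K => (rIdx N k.1, sIdx N k.1) := fun a b hab => by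
  have h1 := two_mul_eq (N := N) (k := a.1)
  have h2 := two_mul_eq (N := N) (k := b.1)
  simp only [Prod.mk.injEq] at hab
  rw [hab.1, hab.2] at h1
  exact Subtype.ext (by omega)

/-- Since k ↦ (r_k, s_k) is injective and all terms are nonnegative, the sum over k is at most the
full double sum, which is a product of two series. -/
theorem summable_and_tsum_le_of_le (N : ℕ) {f : Level K → ℝ} {u v w : ℕ → ℝ} {c : ℝ}
    (hc : 0 ≤ c) (hu0 : ∀ n, 0 ≤ u n) (hv0 : ∀ n, 0 ≤ v n) (hw0 : ∀ n, 0 ≤ w n)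
    (hu : Summable u) (hv : Summable v) (hw : Summable w) (hf0 : ∀ k, 0 ≤ f k)
    (hf : ∀ k, k.1 = 0 → f k = 1)
    (hle : ∀ k, k.1 ≠ 0 → f k ≤ w k.1 + c * (u (rIdx N k.1) * v (sIdx N k.1))) :
    Summable f ∧ ∑' k, f k ≤ 1 + ((∑' n, w n) + c * ((∑' n, u n) * ∑' n, v n)) := by
  have huv : Summable fun p : ℕ × ℕ => u p.1 * v p.2 := hu.mul_of_nonneg hv hu0 hv0
  have huv0 : ∀ p : ℕ × ℕ, 0 ≤ u p.1 * v p.2 := fun p => mul_nonneg (hu0 _) (hv0 _)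
  have hinj := injective_rIdx_sIdx N K
  have hprod : ∑' k : Level K, u (rIdx N k.1) * v (sIdx N k.1) ≤ (∑' n, u n) * ∑' n, v n := by
    rw [hu.tsum_mul_tsum hv huv]
    exact tsum_comp_le_tsum_of_inj huv huv0 hinj
  have hprods : Summable fun k : Level K => u (rIdx N k.1) * v (sIdx N k.1) :=
    huv.comp_injective hinj
  have hwL : Summable fun k : Level K => w k.1 := hw.comp_injective Subtype.val_injective
  have hwL' : ∑' k : Level K, w k.1 ≤ ∑' n, w n :=
    tsum_comp_le_tsum_of_inj hw hw0 Subtype.val_injective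
  have he : HasSum (fun k : Level K => if k = ⟨0, by simp⟩ then (1 : ℝ) else 0) 1 :=
    hasSum_ite_eq _ _
  have hle' : ∀ k : Level K, f k ≤ (if k = ⟨0, by simp⟩ then (1 : ℝ) else 0) +
      (w k.1 + c * (u (rIdx N k.1) * v (sIdx N k.1))) := fun k => by
    by_cases hk : k.1 = 0
    · have := hw0 k.1
      have := mul_nonneg hc (huv0 (rIdx N k.1, sIdx N k.1))
      rw [if_pos (Subtype.ext hk), hf k hk]
      linarith
    · rw [if_neg fun h => hk (congrArg Subtype.val h), zero_add]
      exact hle k hk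
  have hsum := he.summable.add (hwL.add (hprods.mul_left c))
  have hS := hsum.of_nonneg_of_le hf0 hle'
  refine ⟨hS, (hS.tsum_le_tsum hle' hsum).trans ?_⟩
  rw [he.summable.tsum_add (hwL.add (hprods.mul_left c)), hwL.tsum_add (hprods.mul_left c),
    tsum_mul_left, he.tsum_eq]
  gcongr

/-- The summand of the series bounded by `1 + G`. -/
def gSeries (N : ℕ) (q z : ℝ) (k : ℕ) : ℝ :=
  if k = 0 then 1 else (k : ℝ) ^ q * mIdx N k * z ^ (2 * k) / ((2 * k)! : ℝ)

theorem summable_gSeries_and_tsum_le {N : ℕ} (hN : 1 ≤ N) {q z : ℝ} (hz : 0 ≤ z)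
    (h : K = ⊤ → z < N) :
    Summable (fun k : Level K => gSeries N q z k.1) ∧
      ∑' k : Level K, gSeries N q z k.1 ≤ 1 + gFun q K N z := by
  have hN' : (0 : ℝ) < N := by exact_mod_cast hN
  have hu : Summable (polylogTerm 0 N (2 * z / N)) :=
    summable_polylogTerm (by positivity) (fun h => absurd h (ENat.natCast_ne_top _))
  have hv : Summable (polylogTerm (1 / 2 - (N : ℝ) / 2 - q) (sTop N K)
      (z ^ N / (N : ℝ) ^ N)) := summable_polylogTerm (by positivity) fun hs => by
    have hK : K = ⊤ := by
      by_contra hK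
      obtain ⟨n, rfl⟩ := ENat.ne_top_iff_exists.1 hK
      exact ENat.natCast_ne_top _ hs
    rw [← div_pow]
    exact pow_lt_one₀ (by positivity) ((div_lt_one hN').2 (h hK)) (by omega)
  have hw : HasSum (fun k : ℕ =>
      if k ∈ Icc 1 (N / 2) then (k : ℝ) ^ q / ((2 * k)! : ℝ) * z ^ (2 * k) else 0)
      (hFun q (N / 2) z) := by
    rw [hFun, sum_congr rfl fun k hk => (if_pos hk).symm]
    exact hasSum_sum_of_ne_finset_zero fun k hk => if_neg hk
  have key := summable_and_tsum_le_of_le N (f := fun k : Level K => gSeries N q z k.1)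
    (gConst_nonneg q N)
    (polylogTerm_nonneg 0 N (by positivity))
    (polylogTerm_nonneg (1 / 2 - (N : ℝ) / 2 - q) (sTop N K) (by positivity))
    (fun k => by split_ifs <;> positivity) hu hv hw.summable
    (fun k => by unfold gSeries mIdx; split_ifs <;> positivity)
    (fun k hk => if_pos hk)
    (fun k hk => by
      rw [gSeries, if_neg hk]
      exact gFun_term_le hN (Nat.one_le_iff_ne_zero.2 hk) k.2 hz)
  refine ⟨key.1, key.2.trans (le_of_eq ?_)⟩
  rw [hw.tsum_eq, gFun, polylog_eq_tsum, polylog_eq_tsum, gConst]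
  ring

theorem gFun_mono {N : ℕ} (hN : 1 ≤ N) {q z z' : ℝ} (hz : 0 ≤ z) (hzz : z ≤ z') (hz' : z' < N) :
    gFun q K N z ≤ gFun q ⊤ N z' := by
  have hN' : (0 : ℝ) < N := by exact_mod_cast hN
  have hz0 := hz.trans hzz
  have h1 : hFun q (N / 2) z ≤ hFun q (N / 2) z' := by
    unfold hFun
    gcongr
  have h2 : polylog 0 N (2 * z / N) ≤ polylog 0 N (2 * z' / N) :=
    polylog_mono le_rfl (by positivity) (by gcongr) fun h => by simp at h
  have h3 : polylog (1 / 2 - (N : ℝ) / 2 - q) (sTop N K) (z ^ N / (N : ℝ) ^ N) ≤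
      polylog (1 / 2 - (N : ℝ) / 2 - q) (sTop N ⊤) (z' ^ N / (N : ℝ) ^ N) := by
    refine polylog_mono le_top (by positivity) (by gcongr) fun _ => ?_
    rw [← div_pow]
    exact pow_lt_one₀ (by positivity) ((div_lt_one hN').2 hz') (by omega)
  have h4 := polylog_nonneg 0 N (z := 2 * z / N) (by positivity)
  have h5 := polylog_nonneg (1 / 2 - (N : ℝ) / 2 - q) (sTop N K) (z := z ^ N / (N : ℝ) ^ N)
    (by positivity)
  have h6 := polylog_nonneg 0 N (z := 2 * z' / N) (by positivity)
  have := Real.pi_pos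
  unfold gFun
  gcongr

theorem gFun_nonneg {N : ℕ} {q z : ℝ} (hz : 0 ≤ z) : 0 ≤ gFun q K N z := by
  have := Real.pi_pos
  have h4 := polylog_nonneg 0 N (z := 2 * z / N) (by positivity)
  have h5 := polylog_nonneg (1 / 2 - (N : ℝ) / 2 - q) (sTop N K) (z := z ^ N / (N : ℝ) ^ N)
    (by positivity)
  have : 0 ≤ hFun q (N / 2) z := sum_nonneg fun k _ => by positivity
  unfold gFun
  positivity

variable {N : ℕ} {B : Matrix (Fin N) (Fin N) ℝ} {a : Coeff N K}

/-! ### The terms of `μ` -/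

theorem idx_zero_eq (I : Idx N 0) : I.1 = 0 := by
  funext i
  exact sum_eq_zero_iff.1 (by simpa using I.2) i (mem_univ i)

theorem sum_idx_zero (f : Idx N 0 → ℝ) : ∑ I, f I = f ⟨0, by simp⟩ :=
  Fintype.sum_eq_single _ fun I hI => absurd (Subtype.ext (idx_zero_eq I)) hI

theorem sum_coeff_zero (a : Coeff N K) (k : Level K) (hk : k.1 = 0) :
    ∑ I, a k I = coeffZero a := by
  obtain ⟨k, hk'⟩ := k
  subst hk
  exact sum_idx_zero _

theorem sum_coeff_nonneg (ha : Nonneg a) (k : Level K) : 0 ≤ ∑ I, a k I :=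
  sum_nonneg fun I _ => ha k I

theorem muTerm_nonneg (hN : 1 ≤ N) (hB : B ∈ matrixSpace N) (ha : Nonneg a) (k : Level K) :
    0 ≤ muTerm a B k :=
  sum_nonneg fun I _ => mul_nonneg (ha k I) (hafRep_pos hN hB I).le

theorem muTerm_le {b : ℝ} (h0 : ∀ i j, 0 ≤ B i j) (hb : ∀ i j, B i j ≤ b) (ha : Nonneg a)
    (k : Level K) : muTerm a B k ≤ (∑ I, a k I) * (b ^ k.1 * oddFactorial k.1) := by
  rw [muTerm, sum_mul]
  exact sum_le_sum fun I _ => mul_le_mul_of_nonneg_left (hafRep_le h0 hb I.1 I.2) (ha k I)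

theorem le_muTerm {b : ℝ} (h0 : 0 ≤ b) (hb : ∀ i j, b ≤ B i j) (ha : Nonneg a)
    (k : Level K) : (∑ I, a k I) * (b ^ k.1 * oddFactorial k.1) ≤ muTerm a B k := by
  rw [muTerm, sum_mul]
  exact sum_le_sum fun I _ => mul_le_mul_of_nonneg_left (le_hafRep h0 hb I.1 I.2) (ha k I)

/-! ### The second moment of the GBS probability estimator -/

/-- The sums `∑_{|J|=2k} a_J J! / Haf(B_J)`. -/
def invTerm (a : Coeff N K) (B : Matrix (Fin N) (Fin N) ℝ) (k : Level K) : ℝ :=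
  ∑ J, a k J * multiFactorial J.1 / hafRep B J.1

theorem gbspTerm_eq (a : Coeff N K) (B : Matrix (Fin N) (Fin N) ℝ) (p : Level K × Level K) :
    gbspTerm a B p = muTerm a B p.1 * invTerm a B p.2 := by
  rw [gbspTerm, muTerm, invTerm, sum_mul_sum]
  refine sum_congr rfl fun I _ => sum_congr rfl fun J _ => ?_
  ring

theorem muTerm_le_invTerm (hN : 1 ≤ N) (hB : B ∈ matrixSpace N) (ha : Nonneg a) (k : Level K) :
    muTerm a B k ≤ invTerm a B k := by
  refine sum_le_sum fun I _ => ?_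
  rw [mul_div_assoc]
  refine mul_le_mul_of_nonneg_left ?_ (ha k I)
  rw [le_div_iff₀ (hafRep_pos hN hB I), ← pow_two]
  exact hafRep_sq_le hB I.1

/-- `k^q`, with value `1` at `k = 0`. -/
def powWeight (q : ℝ) (k : ℕ) : ℝ := if k = 0 then 1 else (k : ℝ) ^ q

@[simp] theorem powWeight_zero (q : ℝ) : powWeight q 0 = 1 := if_pos rfl

theorem powWeight_of_pos (q : ℝ) {k : ℕ} (hk : 1 ≤ k) : powWeight q k = (k : ℝ) ^ q :=
  if_neg (by omega)

theorem powWeight_pos (q : ℝ) (k : ℕ) : 0 < powWeight q k := by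
  unfold powWeight
  split_ifs with h
  · exact one_pos
  · have : (0 : ℝ) < k := by exact_mod_cast Nat.pos_of_ne_zero h
    positivity

theorem mIdx_zero (N : ℕ) : mIdx N 0 = 1 := by
  have h : sIdx N 0 = 0 := by simp [sIdx]
  simp [mIdx, h]

theorem gSeries_eq (N : ℕ) (q z : ℝ) (k : ℕ) :
    gSeries N q z k = powWeight q k * mIdx N k * z ^ (2 * k) / ((2 * k)! : ℝ) := by
  unfold gSeries powWeight
  split_ifs with h
  · simp [h, mIdx_zero]
  · rfl

/-- Dividing γ^k/k! by b_min^k (2k)!/(2^k k!) leaves (2γ/b_min)^k/(2k)!, whence the square root as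
argument of G. -/
theorem invTerm_le (hN : 1 ≤ N) (hB : B ∈ matrixSpace N) (ha : Nonneg a) {M q γ : ℝ}
    (hγ : 0 < γ) (k : Level K)
    (hk : ∑ I, a k I * multiFactorial I.1 ≤
      M * (powWeight q k.1 * γ ^ k.1 / (k.1 ! : ℝ)) * mIdx N k.1) :
    invTerm a B k ≤ M * gSeries N q (√(2 * γ * (bMin B)⁻¹)) k.1 := by
  have hb := bMin_pos hN hB
  have ho := oddFactorial_pos k.1
  calc invTerm a B k ≤ ∑ I, a k I * multiFactorial I.1 / (bMin B ^ k.1 * oddFactorial k.1) := by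
        refine sum_le_sum fun I _ => ?_
        have := mul_nonneg (ha k I) (multiFactorial_pos I.1).le
        gcongr
        exact le_hafRep hb.le (bMin_le B) I.1 I.2
    _ = (∑ I, a k I * multiFactorial I.1) / (bMin B ^ k.1 * oddFactorial k.1) := by
        rw [sum_div]
    _ ≤ M * (powWeight q k.1 * γ ^ k.1 / (k.1 ! : ℝ)) * mIdx N k.1 /
          (bMin B ^ k.1 * oddFactorial k.1) := by gcongr
    _ = _ := by
        rw [gSeries_eq, pow_mul, Real.sq_sqrt (by positivity), oddFactorial, mul_pow, mul_pow,
          inv_pow]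
        have : (k.1 ! : ℝ) ≠ 0 := by positivity
        field_simp

theorem gbsp_bounds (hN : 1 ≤ N) (hB : B ∈ matrixSpace N) (ha : Nonneg a)
    (hμ : Summable (muTerm a B)) {M q γ : ℝ} (hγ : 0 < γ)
    (hk : ∀ k : Level K, ∑ I, a k I * multiFactorial I.1 ≤
      M * (powWeight q k.1 * γ ^ k.1 / (k.1 ! : ℝ)) * mIdx N k.1)
    (hM : 0 ≤ M) (hK : K = ⊤ → 2 * γ * (bMin B)⁻¹ < (N : ℝ) ^ 2) :
    Summable (gbspTerm a B) ∧ muHaf a B ^ 2 ≤ qGBSP a B ∧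
      qGBSP a B ≤ M * muHaf a B / dConst B * (1 + gFun q K N (√(2 * γ * (bMin B)⁻¹))) := by
  have hμ0 := muTerm_nonneg hN hB ha
  have hmi := muTerm_le_invTerm hN hB ha
  obtain ⟨hs, hle⟩ := summable_gSeries_and_tsum_le (K := K) hN (q := q)
    (z := √(2 * γ * (bMin B)⁻¹)) (Real.sqrt_nonneg _) fun h => by
      rw [Real.sqrt_lt' (by exact_mod_cast hN)]
      exact hK h
  have hi : Summable (invTerm a B) :=
    (hs.mul_left M).of_nonneg_of_le (fun k => (hμ0 k).trans (hmi k))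
      fun k => invTerm_le hN hB ha hγ k (hk k)
  have hi0 : ∀ k, 0 ≤ invTerm a B k := fun k => (hμ0 k).trans (hmi k)
  have hg : Summable fun p : Level K × Level K => muTerm a B p.1 * invTerm a B p.2 :=
    hμ.mul_of_nonneg hi hμ0 hi0
  have hQ : qGBSP a B = muHaf a B * (∑' k, invTerm a B k) / dConst B := by
    rw [qGBSP, tsum_congr (gbspTerm_eq a B), ← hμ.tsum_mul_tsum hi hg, muHaf]
    ring
  have hd := dConst_pos hB
  have hmu : 0 ≤ muHaf a B := tsum_nonneg hμ0
  refine ⟨hg.congr fun p => (gbspTerm_eq a B p).symm, ?_, ?_⟩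
  · rw [hQ, le_div_iff₀ hd]
    calc muHaf a B ^ 2 * dConst B ≤ muHaf a B ^ 2 * 1 := by
          gcongr; exact dConst_le_one B
      _ = muHaf a B * muHaf a B := by ring
      _ ≤ _ := mul_le_mul_of_nonneg_left (hμ.tsum_le_tsum hmi hi) hmu
  · rw [hQ]
    have h1 : ∑' k, invTerm a B k ≤ M * (1 + gFun q K N (√(2 * γ * (bMin B)⁻¹))) := by
      refine (hi.tsum_le_tsum (fun k => invTerm_le hN hB ha hγ k (hk k)) (hs.mul_left M)).trans ?_
      rw [tsum_mul_left]
      exact mul_le_mul_of_nonneg_left hle hM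
    calc muHaf a B * (∑' k, invTerm a B k) / dConst B
        ≤ muHaf a B * (M * (1 + gFun q K N (√(2 * γ * (bMin B)⁻¹)))) / dConst B := by gcongr
      _ = _ := by ring

/-! ### The second moment of plain Monte Carlo -/

theorem sum_idx_add {k l : ℕ} (I : Idx N k) (J : Idx N l) :
    ∑ i, (I.1 + J.1) i = 2 * (k + l) := by
  simp only [Pi.add_apply, sum_add_distrib, I.2, J.2]
  ring

theorem mcTerm_nonneg (hN : 1 ≤ N) (hB : B ∈ matrixSpace N) (ha : Nonneg a)
    (p : Level K × Level K) : 0 ≤ mcTerm a B p :=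
  sum_nonneg fun I _ => sum_nonneg fun J _ => mul_nonneg (mul_nonneg (ha _ I) (ha _ J))
    (hafRep_pos (k := p.1.1 + p.2.1) hN hB ⟨I.1 + J.1, sum_idx_add I J⟩).le

theorem mcTerm_le (hB : B ∈ matrixSpace N) (ha : Nonneg a) (p : Level K × Level K) :
    mcTerm a B p ≤ (∑ I, a p.1 I) * (∑ J, a p.2 J) *
      (bMax B ^ (p.1.1 + p.2.1) * oddFactorial (p.1.1 + p.2.1)) := by
  rw [mcTerm, sum_mul_sum, sum_mul]
  refine sum_le_sum fun I _ => ?_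
  rw [sum_mul]
  exact sum_le_sum fun J _ => mul_le_mul_of_nonneg_left
    (hafRep_le (fun i j => (hB.1 i j).le) (le_bMax B) _ (sum_idx_add I J))
    (mul_nonneg (ha _ I) (ha _ J))

theorem le_mcTerm (hN : 1 ≤ N) (hB : B ∈ matrixSpace N) (ha : Nonneg a) (p : Level K × Level K) :
    (∑ I, a p.1 I) * (∑ J, a p.2 J) *
      (bMin B ^ (p.1.1 + p.2.1) * oddFactorial (p.1.1 + p.2.1)) ≤ mcTerm a B p := by
  rw [mcTerm, sum_mul_sum, sum_mul]
  refine sum_le_sum fun I _ => ?_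
  rw [sum_mul]
  exact sum_le_sum fun J _ => mul_le_mul_of_nonneg_left
    (le_hafRep (bMin_pos hN hB).le (bMin_le B) _ (sum_idx_add I J))
    (mul_nonneg (ha _ I) (ha _ J))

/-- Decouples the two levels, so that the Monte Carlo series is dominated by a product of two series
with ratio 4γ b_max. -/
theorem oddFactorial_add_le (k l : ℕ) : oddFactorial (k + l) ≤ 4 ^ k * k ! * (4 ^ l * l !) := by
  have h1 : ((k + l)! : ℝ) ≤ 2 ^ (k + l) * k ! * l ! := by
    rw [← Nat.add_choose_mul_factorial_mul_factorial k l]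
    push_cast
    gcongr
    exact_mod_cast Nat.choose_le_two_pow _ _
  calc oddFactorial (k + l) = centralRatio (k + l) * 2 ^ (k + l) * (k + l)! := oddFactorial_eq _
    _ ≤ 1 * 2 ^ (k + l) * (2 ^ (k + l) * k ! * l !) := by
        gcongr
        exact centralRatio_le_one _
    _ = 4 ^ k * k ! * (4 ^ l * l !) := by
        have : ∀ n : ℕ, (4 : ℝ) ^ n = 2 ^ n * 2 ^ n := fun n => by rw [← mul_pow]; norm_num
        rw [this, this, pow_add]
        ring

theorem summable_mcTerm (hN : 1 ≤ N) (hB : B ∈ matrixSpace N) (ha : Nonneg a) {M q γ : ℝ}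
    (hγ : 0 < γ) (hM : 0 ≤ M)
    (hk : ∀ k : Level K, ∑ I, a k I ≤ M * (powWeight q k.1 * γ ^ k.1 / (k.1 ! : ℝ)))
    (hK : K = ⊤ → 4 * γ * bMax B < 1) : Summable (mcTerm a B) := by
  have hb : 0 < bMax B := (bMin_pos hN hB).trans_le (bMin_le_bMax hN)
  let f : Level K → ℝ := fun k => M * (powWeight q k.1 * (4 * γ * bMax B) ^ k.1)
  have hf0 : ∀ k, 0 ≤ f k := fun k => by
    have := (powWeight_pos q k.1).le
    simp only [f]
    positivity
  have hf : Summable f := by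
    refine Summable.mul_left M ?_
    refine ((hasSum_one_add_polylog (K := K) (s := -q) 1
      (z := 4 * γ * bMax B) (by positivity) hK).summable).congr fun k => ?_
    unfold powWeight
    split_ifs with h
    · simp [h]
    · rw [one_mul, Real.rpow_neg (Nat.cast_nonneg _), div_inv_eq_mul, mul_comm]
  refine (hf.mul_of_nonneg hf hf0 hf0).of_nonneg_of_le (mcTerm_nonneg hN hB ha) fun p => ?_
  have h1 := (powWeight_pos q p.1.1).le
  have h2 := (powWeight_pos q p.2.1).le
  have h3 := (oddFactorial_pos (p.1.1 + p.2.1)).le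
  have h4 := sum_coeff_nonneg ha p.2
  calc mcTerm a B p ≤ _ := mcTerm_le hB ha p
    _ ≤ (M * (powWeight q p.1.1 * γ ^ p.1.1 / (p.1.1 ! : ℝ))) *
          (M * (powWeight q p.2.1 * γ ^ p.2.1 / (p.2.1 ! : ℝ))) *
          (bMax B ^ (p.1.1 + p.2.1) *
            (4 ^ p.1.1 * p.1.1 ! * (4 ^ p.2.1 * p.2.1 !))) := by
        gcongr
        · exact hk _
        · exact hk _
        · exact oddFactorial_add_le _ _
    _ = f p.1 * f p.2 := by
        have e1 : (p.1.1 ! : ℝ) ≠ 0 := by positivity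
        have e2 : (p.2.1 ! : ℝ) ≠ 0 := by positivity
        simp only [f, mul_pow, pow_add]
        field_simp

/-- The factor `ρ` in `2 √π R_{q,K} = ρ Li_{s,K}`. -/
def rScale (q : ℝ) : ℝ := if 0 ≤ q then (2 : ℝ) ^ (-q) else 1

/-- The order of the polylogarithm in `R_{q,K}`. -/
def rOrder (q : ℝ) : ℝ := if 0 ≤ q then 1 / 2 - q else 1 / 2 - 2 * q

theorem rScale_nonneg (q : ℝ) : 0 ≤ rScale q := by
  unfold rScale; split_ifs <;> positivity

theorem two_mul_rFun (q : ℝ) (K : ℕ∞) (z : ℝ) :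
    2 * eConst * rFun q K z = (rScale q * (1 / √Real.pi * eConst)) * polylog (rOrder q) K z := by
  have : √Real.pi ≠ 0 := (Real.sqrt_pos.2 Real.pi_pos).ne'
  unfold rFun rScale rOrder
  split_ifs
  · field_simp
  · field_simp

/-- For q ≥ 0 the bound is kl ≥ (k+l)/2 for positive k, l, and the loss 2^{-q} also covers a zero
level. For q < 0 each weight is at least (k+l)^q, which doubles q in the order. -/
theorem rScale_mul_le_powWeight (q : ℝ) {k l : ℕ} (h : 1 ≤ k + l) :
    rScale q * √(k + l : ℕ) / ((k + l : ℕ) : ℝ) ^ rOrder q ≤ powWeight q k * powWeight q l := by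
  have hn1 : (1 : ℝ) ≤ ((k + l : ℕ) : ℝ) := by exact_mod_cast h
  have hn0 : (0 : ℝ) < ((k + l : ℕ) : ℝ) := by linarith
  rw [mul_div_assoc, Real.sqrt_eq_rpow, ← Real.rpow_sub hn0]
  unfold rScale rOrder
  have two_rpow : ∀ {q : ℝ}, 0 ≤ q → (2 : ℝ) ^ (-q) ≤ 1 := fun hq =>
    Real.rpow_le_one_of_one_le_of_nonpos (by norm_num) (by linarith)
  split_ifs with hq
  · rw [show (1 / 2 - (1 / 2 - q)) = q by ring]
    rcases Nat.eq_zero_or_pos k with hk | hk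
    · subst hk
      rw [powWeight_zero, powWeight_of_pos q (by omega), zero_add]
      exact mul_le_mul_of_nonneg_right (two_rpow hq) (by positivity)
    · rcases Nat.eq_zero_or_pos l with hl | hl
      · subst hl
        rw [powWeight_zero, powWeight_of_pos q (by omega), add_zero, mul_one]
        exact mul_le_of_le_one_left (by positivity) (two_rpow hq)
      · rw [powWeight_of_pos q hk, powWeight_of_pos q hl, Real.rpow_neg (by norm_num),
          inv_mul_eq_div, ← Real.div_rpow hn0.le (by norm_num),
          ← Real.mul_rpow (Nat.cast_nonneg _) (Nat.cast_nonneg _)]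
        refine Real.rpow_le_rpow (by positivity) ?_ hq
        have hk' : (1 : ℝ) ≤ k := by exact_mod_cast hk
        have hl' : (1 : ℝ) ≤ l := by exact_mod_cast hl
        push_cast
        nlinarith
  · push Not at hq
    rw [show (1 / 2 - (1 / 2 - 2 * q)) = q + q by ring, one_mul, Real.rpow_add hn0]
    have key : ∀ m : ℕ, m ≤ k + l → ((k + l : ℕ) : ℝ) ^ q ≤ powWeight q m := fun m hm => by
      rcases Nat.eq_zero_or_pos m with h0 | h0
      · subst h0
        rw [powWeight_zero]
        exact Real.rpow_le_one_of_one_le_of_nonpos hn1 hq.le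
      · rw [powWeight_of_pos q h0]
        exact Real.rpow_le_rpow_of_nonpos (by exact_mod_cast h0) (by exact_mod_cast hm) hq.le
    exact mul_le_mul (key k (by omega)) (key l (by omega)) (by positivity) (powWeight_pos q k).le

theorem sum_antidiagonal_inv_factorial (n : ℕ) :
    ∑ p ∈ antidiagonal n, 1 / ((p.1 ! : ℝ) * p.2 !) = 2 ^ n / n ! := by
  have h := (Commute.all (1 : ℝ) 1).add_pow' n
  rw [one_add_one_eq_two] at h
  rw [h, sum_div]
  refine sum_congr rfl fun p hp => ?_
  rw [← mem_antidiagonal.1 hp]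
  have := Nat.add_choose_mul_factorial_mul_factorial p.1 p.2
  rw [← this, Nat.choose_symm_add]
  have hc : ((p.1 + p.2).choose p.2 : ℝ) ≠ 0 := by
    exact_mod_cast (Nat.choose_pos (by omega)).ne'
  push_cast
  simp only [one_pow, mul_one, nsmul_eq_mul]
  field_simp

/-- A lower bound for the terms of `Q^{MC}`. -/
def mcLower (q γ b : ℝ) (p : ℕ × ℕ) : ℝ :=
  (powWeight q p.1 * γ ^ p.1 / (p.1 ! : ℝ)) * (powWeight q p.2 * γ ^ p.2 / (p.2 ! : ℝ)) *
    (b ^ (p.1 + p.2) * oddFactorial (p.1 + p.2))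

theorem mcLower_nonneg (q : ℝ) {γ b : ℝ} (hγ : 0 ≤ γ) (hb : 0 ≤ b) (p : ℕ × ℕ) :
    0 ≤ mcLower q γ b p := by
  have h1 := (powWeight_pos q p.1).le
  have h2 := (powWeight_pos q p.2).le
  have h3 := (oddFactorial_pos (p.1 + p.2)).le
  unfold mcLower
  positivity

/-- The double factorial depends only on n = k + l, and Σ 1/(k! l!) = 2^n/n!. Apart from the
weights, the sum is therefore binom(2n,n)/4^n · (4γb)^n. -/
theorem le_sum_antidiagonal_mcLower (q : ℝ) {γ b : ℝ} (hγ : 0 ≤ γ) (hb : 0 ≤ b) {n : ℕ}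
    (hn : 1 ≤ n) :
    (rScale q * (1 / √Real.pi * eConst)) * ((4 * γ * b) ^ n / (n : ℝ) ^ rOrder q) ≤
      ∑ p ∈ antidiagonal n, mcLower q γ b p := by
  have hn0 : (0 : ℝ) < n := by exact_mod_cast hn
  have hsn : 0 < √(n : ℝ) := Real.sqrt_pos.2 hn0
  have ho := (oddFactorial_pos n).le
  have hr := rScale_nonneg q
  calc (rScale q * (1 / √Real.pi * eConst)) * ((4 * γ * b) ^ n / (n : ℝ) ^ rOrder q)
      = (1 / √Real.pi * eConst / √n) * ((rScale q * √n / (n : ℝ) ^ rOrder q) *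
          (4 * γ * b) ^ n) := by field_simp
    _ ≤ centralRatio n * ((rScale q * √n / (n : ℝ) ^ rOrder q) * (4 * γ * b) ^ n) := by
        refine mul_le_mul_of_nonneg_right (eConst_div_lt_centralRatio hn).le ?_
        positivity
    _ = (rScale q * √n / (n : ℝ) ^ rOrder q) * γ ^ n * (b ^ n * oddFactorial n) *
          (2 ^ n / n !) := by
        have : (4 : ℝ) ^ n = 2 ^ n * 2 ^ n := by rw [← mul_pow]; norm_num
        have h0 : (n ! : ℝ) ≠ 0 := by positivity
        rw [oddFactorial_eq, mul_pow, mul_pow, this]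
        field_simp
    _ = ∑ p ∈ antidiagonal n, (rScale q * √n / (n : ℝ) ^ rOrder q) * γ ^ n *
          (b ^ n * oddFactorial n) * (1 / ((p.1 ! : ℝ) * p.2 !)) := by
        rw [← mul_sum, sum_antidiagonal_inv_factorial]
    _ ≤ ∑ p ∈ antidiagonal n, mcLower q γ b p := by
        refine sum_le_sum fun p hp => ?_
        have hp' := mem_antidiagonal.1 hp
        have hw := rScale_mul_le_powWeight q (k := p.1) (l := p.2) (by omega)
        rw [hp'] at hw
        calc _ ≤ (powWeight q p.1 * powWeight q p.2) * γ ^ n *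
              (b ^ n * oddFactorial n) * (1 / ((p.1 ! : ℝ) * p.2 !)) := by gcongr
          _ = _ := by
              rw [mcLower, hp', ← hp', pow_add γ]
              field_simp

theorem lt_qMC (hN : 1 ≤ N) (hB : B ∈ matrixSpace N) (ha : Nonneg a)
    (hs : Summable (mcTerm a B)) {L q γ : ℝ} (hγ : 0 < γ) (hL : 0 < L) (h0 : L < coeffZero a)
    (hk : ∀ k : Level K, L * (powWeight q k.1 * γ ^ k.1 / (k.1 ! : ℝ)) ≤ ∑ I, a k I)
    (hK : K = ⊤ → 4 * γ * bMin B < 1) :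
    L ^ 2 * (1 + 2 * eConst * rFun q K (4 * γ * bMin B)) < qMC a B := by
  have hb := bMin_pos hN hB
  set g := mcLower q γ (bMin B) with hg
  have hg0 : ∀ p, 0 ≤ g p := mcLower_nonneg q hγ.le hb.le
  have hle : ∀ p : Level K × Level K, L ^ 2 * g (p.1.1, p.2.1) ≤ mcTerm a B p := fun p => by
    refine le_trans ?_ (le_mcTerm hN hB ha p)
    have h1 := (powWeight_pos q p.1.1).le
    have h2 := (powWeight_pos q p.2.1).le
    have h3 := (oddFactorial_pos (p.1.1 + p.2.1)).le
    have h4 := sum_coeff_nonneg ha p.1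
    calc L ^ 2 * g (p.1.1, p.2.1) = (L * (powWeight q p.1.1 * γ ^ p.1.1 / (p.1.1 ! : ℝ))) *
          (L * (powWeight q p.2.1 * γ ^ p.2.1 / (p.2.1 ! : ℝ))) *
          (bMin B ^ (p.1.1 + p.2.1) * oddFactorial (p.1.1 + p.2.1)) := by
          rw [hg, mcLower]; ring
      _ ≤ _ := by
          gcongr
          · exact hk _
          · exact hk _
  have hsg : Summable fun p : Level K × Level K => L ^ 2 * g (p.1.1, p.2.1) :=
    hs.of_nonneg_of_le (fun p => mul_nonneg (by positivity) (hg0 _)) hle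
  -- Strictness comes from the pair (0, 0) alone, where L² < a_0².
  have hlt : ∑' p : Level K × Level K, L ^ 2 * g (p.1.1, p.2.1) < qMC a B := by
    refine Summable.tsum_lt_tsum (i := (⟨0, by simp⟩, ⟨0, by simp⟩)) hle ?_ hsg hs
    refine lt_of_lt_of_le ?_ (le_mcTerm hN hB ha _)
    rw [sum_coeff_zero a ⟨0, by simp⟩ rfl, hg]
    simp only [mcLower, powWeight_zero, oddFactorial]
    norm_num
    nlinarith
  refine lt_of_le_of_lt ?_ hlt
  rw [tsum_mul_left]
  refine mul_le_mul_of_nonneg_left ?_ (by positivity)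
  have hsg' : Summable fun p : Level K × Level K => g (p.1.1, p.2.1) := by
    have := hsg.mul_left (L ^ 2)⁻¹
    refine this.congr fun p => ?_
    field_simp
  let h : ℕ × ℕ → ℝ := fun p => if (p.1 : ℕ∞) ≤ K ∧ (p.2 : ℕ∞) ≤ K then g p else 0
  have hinj : Function.Injective fun p : Level K × Level K => (p.1.1, p.2.1) := fun p p' hp => by
    simp only [Prod.mk.injEq] at hp
    exact Prod.ext (Subtype.ext hp.1) (Subtype.ext hp.2)
  have hh : HasSum h (∑' p : Level K × Level K, g (p.1.1, p.2.1)) := by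
    rw [← hinj.hasSum_iff]
    · convert hsg'.hasSum using 1
      funext p
      exact if_pos ⟨p.1.2, p.2.2⟩
    · intro p hp
      refine if_neg fun hp' => hp ⟨(⟨p.1, hp'.1⟩, ⟨p.2, hp'.2⟩), rfl⟩
  have hh0 : ∀ p, 0 ≤ h p := fun p => by
    simp only [h]
    split_ifs
    · exact hg0 p
    · exact le_rfl
  rw [← hh.tsum_eq]
  have hσ : Summable fun x : Σ n : ℕ, antidiagonal n => h x.2 :=
    (HasAntidiagonal.sigmaAntidiagonalEquivProd.summable_iff (f := h)).2 hh.summable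
  have hσ' : ∑' p, h p = ∑' n, ∑ p ∈ antidiagonal n, h p := by
    rw [← HasAntidiagonal.sigmaAntidiagonalEquivProd.tsum_eq h]
    refine hσ.tsum_sigma.trans (tsum_congr fun n => ?_)
    rw [tsum_fintype]
    exact sum_coe_sort (antidiagonal n) h
  have hσs : Summable fun n => ∑ p ∈ antidiagonal n, h p := by
    refine hσ.sigma.congr fun n => ?_
    rw [tsum_fintype]
    exact sum_coe_sort (antidiagonal n) h
  have hR := hasSum_nat_one_add_polylog (K := K) (s := rOrder q)
    (rScale q * (1 / √Real.pi * eConst)) (z := 4 * γ * bMin B) (by positivity) hK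
  rw [hσ', two_mul_rFun, ← hR.tsum_eq]
  refine hR.summable.tsum_le_tsum (fun n => ?_) hσs
  rcases Nat.eq_zero_or_pos n with hn | hn
  · subst hn
    simp [h, hg, mcLower, polylogTerm, oddFactorial]
  · by_cases hnK : (n : ℕ∞) ≤ K
    · rw [if_neg (by omega), zero_add, polylogTerm_of_le hn hnK]
      -- For n ≤ K the whole antidiagonal survives the truncation; total degrees above K are only
      -- bounded below by 0.
      refine (le_sum_antidiagonal_mcLower q hγ.le hb.le hn).trans (le_of_eq ?_)
      refine sum_congr rfl fun p hp => (if_pos ?_).symm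
      have hp' := mem_antidiagonal.1 hp
      exact ⟨le_trans (Nat.cast_le.2 (by omega)) hnK, le_trans (Nat.cast_le.2 (by omega)) hnK⟩
    · rw [if_neg (by omega), polylogTerm, if_neg fun h => hnK h.2]
      simp only [mul_zero, add_zero]
      exact sum_nonneg fun p _ => hh0 p

/-! ### The comparison of the sample sizes -/

/-- With t = ε²δ, exponentiating the hypothesis gives m² E (t+1) max(s₂,1) < X for E = exp(s₁ n),
where n is the smaller sample size. The part with t yields the claim, and the part with 1 absorbs
the subtracted m² because E ≥ 1; `hP` is needed for this. -/
theorem lt_of_log_bound {s₁ s₂ ε δ P X m c c' d G R : ℝ} (hε : 0 < ε) (hδ : 0 < δ)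
    (hs₁ : 0 < s₁) (hm : 0 < m) (hc' : 0 < c') (hR : 0 ≤ R)
    (h : s₁ / (ε ^ 2 * δ) * (c / d) * (1 + G) ≤ Real.log (1 + R) + 2 * Real.log c' -
      Real.log (ε ^ 2 * δ + 1) + s₁ / (ε ^ 2 * δ) - Real.log (max s₂ 1))
    (hP : m ^ 2 ≤ P) (hP' : P ≤ c * m * m / d * (1 + G)) (hX : (c' * m) ^ 2 * (1 + R) < X) :
    s₂ * Real.exp (s₁ * ((P - m ^ 2) / (δ * ε ^ 2 * m ^ 2))) <
      (X - m ^ 2) / (δ * ε ^ 2 * m ^ 2) := by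
  set t := ε ^ 2 * δ with ht
  have ht0 : 0 < t := by positivity
  have hte : δ * ε ^ 2 = t := mul_comm _ _
  have hmax : 0 < max s₂ 1 := lt_max_of_lt_right one_pos
  rw [hte]
  set n := (P - m ^ 2) / (t * m ^ 2) with hn
  have hm2 : 0 < m ^ 2 := by positivity
  have hn0 : 0 ≤ n := div_nonneg (by linarith) (by positivity)
  have hn1 : s₁ * n ≤ s₁ / t * (c / d) * (1 + G) - s₁ / t := by
    have : P - m ^ 2 ≤ m ^ 2 * (c / d * (1 + G) - 1) := by
      calc P - m ^ 2 ≤ c * m * m / d * (1 + G) - m ^ 2 := by linarith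
        _ = _ := by ring
    calc s₁ * n ≤ s₁ * (m ^ 2 * (c / d * (1 + G) - 1) / (t * m ^ 2)) := by
          rw [hn]; gcongr
      _ = _ := by field_simp
  have hexp1 : 1 ≤ Real.exp (s₁ * n) := Real.one_le_exp (by positivity)
  have hlog : s₁ * n ≤ Real.log ((1 + R) * c' ^ 2 / ((t + 1) * max s₂ 1)) := by
    rw [Real.log_div (by positivity) (by positivity), Real.log_mul (by positivity) (by positivity),
      Real.log_mul (by positivity) (by positivity), Real.log_pow]
    push_cast
    linarith
  have hE : Real.exp (s₁ * n) ≤ (1 + R) * c' ^ 2 / ((t + 1) * max s₂ 1) := by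
    refine (Real.exp_le_exp.2 hlog).trans (le_of_eq (Real.exp_log (by positivity)))
  rw [le_div_iff₀ (by positivity)] at hE
  set E := Real.exp (s₁ * n)
  have hs : s₂ ≤ max s₂ 1 := le_max_left _ _
  have h1 : 1 ≤ max s₂ 1 := le_max_right _ _
  rw [lt_div_iff₀ (by positivity)]
  have hE' : m ^ 2 * (E * ((t + 1) * max s₂ 1)) < X := by
    refine lt_of_le_of_lt (mul_le_mul_of_nonneg_left hE hm2.le) ?_
    linarith
  have h2 : s₂ * E ≤ max s₂ 1 * E := mul_le_mul_of_nonneg_right hs (by linarith)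
  have h3 : 1 ≤ max s₂ 1 * E := one_le_mul_of_one_le_of_one_le h1 hexp1
  have h4 : s₂ * E * (t * m ^ 2) ≤ max s₂ 1 * E * (t * m ^ 2) :=
    mul_le_mul_of_nonneg_right h2 (by positivity)
  have h5 : m ^ 2 * 1 ≤ m ^ 2 * (max s₂ 1 * E) := mul_le_mul_of_nonneg_left h3 hm2.le
  nlinarith

theorem rFun_nonneg (q : ℝ) (K : ℕ∞) {z : ℝ} (hz : 0 ≤ z) : 0 ≤ rFun q K z := by
  have := polylog_nonneg (1 / 2 - q) K hz
  have := polylog_nonneg (1 / 2 - 2 * q) K hz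
  unfold rFun
  split_ifs <;> positivity

theorem one_le_cOne (hN : 1 ≤ N) (hB : B ∈ matrixSpace N) {γ q : ℝ} (hγ : 0 < γ) :
    1 ≤ cOne K γ q B := by
  have := bMin_pos hN hB
  have := polylog_nonneg (1 / 2 - q) K (z := 2 * γ * bMin B) (by positivity)
  have := eConst_pos
  unfold cOne
  exact le_add_of_nonneg_right (by positivity)

theorem one_le_cTwo (hN : 1 ≤ N) (hB : B ∈ matrixSpace N) {γ q : ℝ} (hγ : 0 < γ) :
    1 ≤ cTwo K γ q B := by
  have := (bMin_pos hN hB).trans_le (bMin_le_bMax hN)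
  have := polylog_nonneg (1 / 2 - q) K (z := 2 * γ * bMax B) (by positivity)
  unfold cTwo
  exact le_add_of_nonneg_right (by positivity)

theorem muHaf_pos_of_coeffConditions (hN : 1 ≤ N) (hB : B ∈ matrixSpace N) (ha : Nonneg a)
    {γα γβ qα qβ : ℝ} (h : CoeffConditions γα γβ qα qβ a B) :
    0 < muHaf a B ∧ Summable (muTerm a B) := by
  have hne : muHaf a B ≠ 0 := fun h0 => by
    have h1 := h.2.2.1
    rw [h0, mul_zero] at h1
    exact absurd h1 (not_lt.2 (ha _ _))
  refine ⟨lt_of_le_of_ne (tsum_nonneg (muTerm_nonneg hN hB ha)) hne.symm, ?_⟩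
  -- A divergent `tsum` has the value 0, so μ ≠ 0 already forces convergence.
  by_contra hs
  exact hne (tsum_eq_zero_of_not_summable hs)

/-- If γ_β < γ_α, the ratio of the two sides tends to 0, being the general term of a convergent
polylogarithm. For K = ∞ this transfers the smallness condition on γ_β b_max to γ_α b_min. -/
theorem pos_le_of_forall_lt_pow {γα γβ qα qβ c c' : ℝ} (hα : 0 < γα) (hβ : 0 < γβ) (hc : 0 < c)
    (hc' : 0 < c') (h : ∀ k : ℕ, 1 ≤ k →
      c * ((k : ℝ) ^ qα * γα ^ k) < c' * ((k : ℝ) ^ qβ * γβ ^ k)) : γα ≤ γβ := by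
  by_contra hlt
  push Not at hlt
  have hsum := summable_polylogTerm (s := qα - qβ) (K := ⊤) (z := γβ / γα) (by positivity)
    fun _ => (div_lt_one hα).2 hlt
  have ht := hsum.tendsto_atTop_zero
  have hev := ht.eventually (gt_mem_nhds (show 0 < c / c' by positivity))
  obtain ⟨k, hk, hk1⟩ := (hev.and (Filter.eventually_ge_atTop 1)).exists
  rw [polylogTerm_of_le hk1 le_top] at hk
  have hk0 : (0 : ℝ) < k := by exact_mod_cast hk1
  have := h k hk1
  rw [div_pow, Real.rpow_sub hk0, lt_div_iff₀ hc'] at hk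
  have h2 : γβ ^ k / γα ^ k / ((k : ℝ) ^ qα / (k : ℝ) ^ qβ) * c' =
      c' * ((k : ℝ) ^ qβ * γβ ^ k) / ((k : ℝ) ^ qα * γα ^ k) := by
    have : (k : ℝ) ^ qα ≠ 0 := (Real.rpow_pos_of_pos hk0 _).ne'
    have : (k : ℝ) ^ qβ ≠ 0 := (Real.rpow_pos_of_pos hk0 _).ne'
    field_simp
  rw [h2, div_lt_iff₀ (by positivity)] at hk
  linarith

theorem coeffSpace_and_sample_size_lt (hN : 1 ≤ N) {ε δ s₁ s₂ γα γβ qα qβ : ℝ} (hε : 0 < ε)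
    (hδ : 0 < δ) (hs₁ : 0 < s₁) (hα : 0 < γα) (hβ : 0 < γβ)
    (hB : B ∈ matrixSubset N K ε δ s₁ s₂ γα γβ qα qβ) (ha : Nonneg a)
    (h : CoeffConditions γα γβ qα qβ a B) :
    a ∈ coeffSpace K B ∧ s₂ * Real.exp (s₁ * nGBSP ε δ a B) < nMC ε δ a B := by
  obtain ⟨hB, hcc, hpow, hlog, hK⟩ := hB
  obtain ⟨hμ, hμs⟩ := muHaf_pos_of_coeffConditions hN hB ha h
  obtain ⟨-, h0l, h0u, hk⟩ := h
  have hb := bMin_pos hN hB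
  have hc1 : 0 < (cOne K γα qα B)⁻¹ := inv_pos.2 (one_pos.trans_le (one_le_cOne hN hB hα))
  have hc2 : 0 < (cTwo K γβ qβ B)⁻¹ := inv_pos.2 (one_pos.trans_le (one_le_cTwo hN hB hβ))
  set c₁ := (cOne K γα qα B)⁻¹
  set c₂ := (cTwo K γβ qβ B)⁻¹
  have hlow : ∀ k : Level K, c₂ * muHaf a B * (powWeight qα k.1 * γα ^ k.1 / (k.1 ! : ℝ)) ≤
      ∑ I, a k I := fun k => by
    rcases Nat.eq_zero_or_pos k.1 with h0 | h0
    · rw [sum_coeff_zero a k h0, h0]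
      simpa using h0l.le
    · rw [powWeight_of_pos _ h0]
      exact (hk k h0).1
  have hup : ∀ k : Level K, ∑ I, a k I ≤
      c₁ * muHaf a B * (powWeight qβ k.1 * γβ ^ k.1 / (k.1 ! : ℝ)) := fun k => by
    rcases Nat.eq_zero_or_pos k.1 with h0 | h0
    · rw [sum_coeff_zero a k h0, h0]
      simpa using h0u.le
    · rw [powWeight_of_pos _ h0]
      exact (hk k h0).2.1
  have hupm : ∀ k : Level K, ∑ I, a k I * multiFactorial I.1 ≤
      c₁ * muHaf a B * (powWeight qβ k.1 * γβ ^ k.1 / (k.1 ! : ℝ)) * mIdx N k.1 := fun k => by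
    obtain ⟨k, hkK⟩ := k
    rcases Nat.eq_zero_or_pos k with h0 | h0
    · subst h0
      rw [sum_idx_zero]
      have h0u' : a ⟨0, hkK⟩ ⟨0, by simp⟩ ≤ c₁ * muHaf a B := h0u.le
      simpa [multiFactorial, mIdx_zero] using h0u'
    · rw [powWeight_of_pos _ h0]
      exact (hk ⟨k, hkK⟩ h0).2.2
  obtain ⟨hgs, hQ1, hQ2⟩ := gbsp_bounds hN hB ha hμs hβ hupm (by positivity) fun h => (hK h).2
  have hmc := summable_mcTerm hN hB ha hβ (by positivity) hup fun h => (hK h).1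
  have hX := lt_qMC hN hB ha hmc hα (by positivity) h0l hlow fun hKt => by
    have h1 : γα ≤ γβ := pos_le_of_forall_lt_pow hα hβ hc2 hc1 fun k hk1 =>
      hpow k hk1 (hKt ▸ le_top)
    refine lt_of_le_of_lt ?_ (hK hKt).1
    have := bMin_le_bMax (B := B) hN
    gcongr
  have hR := rFun_nonneg qα K (z := 4 * γα * bMin B) (by positivity)
  refine ⟨⟨ha, hμs, hμ.ne', hgs, hmc⟩, ?_⟩
  have he := eConst_pos
  exact lt_of_log_bound hε hδ hs₁ hμ hc2 (by positivity) hlog hQ1 hQ2 hX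

/-! ### The generating series of the central ratios -/

theorem hasSum_cOne (hN : 1 ≤ N) (hB : B ∈ matrixSpace N) {γ : ℝ} (hγ : 0 < γ)
    (h : 2 * γ * bMin B < 1) :
    HasSum (fun k : Level K => if k.1 = 0 then 1 else
      1 / √Real.pi * eConst / √k.1 * (2 * γ * bMin B) ^ k.1) (cOne K γ 0 B) := by
  have hb := bMin_pos hN hB
  convert hasSum_one_add_polylog (K := K) (s := 1 / 2 - 0) (1 / √Real.pi * eConst)
    (z := 2 * γ * bMin B) (by positivity) fun _ => h using 1
  · funext k
    rw [sub_zero, ← Real.sqrt_eq_rpow]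
    split_ifs
    · rfl
    · ring
  · rfl

theorem hasSum_cTwo (hN : 1 ≤ N) (hB : B ∈ matrixSpace N) {γ : ℝ} (hγ : 0 < γ)
    (h : 2 * γ * bMax B < 1) :
    HasSum (fun k : Level K => if k.1 = 0 then 1 else
      1 / √Real.pi / √k.1 * (2 * γ * bMax B) ^ k.1) (cTwo K γ 0 B) := by
  have hb := (bMin_pos hN hB).trans_le (bMin_le_bMax hN)
  convert hasSum_one_add_polylog (K := K) (s := 1 / 2 - 0) (1 / √Real.pi)
    (z := 2 * γ * bMax B) (by positivity) fun _ => h using 1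
  · funext k
    rw [sub_zero, ← Real.sqrt_eq_rpow]
    split_ifs
    · rfl
    · ring
  · rfl

/-- The series `∑_{k ≤ K} binom(2k, k) (z / 4)^k`. -/
def centralSeries (K : ℕ∞) (z : ℝ) : ℝ := ∑' k : Level K, centralRatio k.1 * z ^ k.1

theorem summable_centralSeries {z : ℝ} (hz : 0 ≤ z) (h : z < 1) :
    Summable fun k : Level K => centralRatio k.1 * z ^ k.1 := by
  refine ((summable_geometric_of_lt_one hz h).comp_injective
    (Subtype.val_injective (p := fun k : ℕ => (k : ℕ∞) ≤ K))).of_nonneg_of_le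
    (fun k => mul_nonneg (centralRatio_pos _).le (pow_nonneg hz _)) fun k => ?_
  exact mul_le_of_le_one_left (pow_nonneg hz _) (centralRatio_le_one _)

theorem centralSeries_mono {z z' : ℝ} (hz : 0 ≤ z) (hzz : z ≤ z') (h : z' < 1) :
    centralSeries K z ≤ centralSeries K z' := by
  refine (summable_centralSeries hz (hzz.trans_lt h)).tsum_le_tsum (fun k => ?_)
    (summable_centralSeries (hz.trans hzz) h)
  have := (centralRatio_pos k.1).le
  gcongr

theorem tsum_add_le_tsum_of_le {ι : Type*} {f g : ι → ℝ} {c : ℝ} (hf : Summable f)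
    (hg : Summable g) (hle : ∀ i, f i ≤ g i) (i : ι) (hi : f i + c ≤ g i) :
    ∑' i, f i + c ≤ ∑' i, g i := by
  have h := (hg.sub hf).le_tsum i fun j _ => sub_nonneg.2 (hle j)
  rw [hg.tsum_sub hf] at h
  linarith

/-- Termwise comparison, keeping the difference at k = 1 as a gap that is uniform in K. -/
theorem cOne_add_le (hN : 1 ≤ N) (hB : B ∈ matrixSpace N) (hK : 1 ≤ K) {γ : ℝ} (hγ : 0 < γ)
    (h : 2 * γ * bMin B < 1) :
    cOne K γ 0 B + (1 / 2 - 1 / √Real.pi * eConst) * (2 * γ * bMin B) ≤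
      centralSeries K (2 * γ * bMin B) := by
  have hb := bMin_pos hN hB
  have hs := hasSum_cOne (K := K) hN hB hγ h
  rw [← hs.tsum_eq]
  refine tsum_add_le_tsum_of_le hs.summable (summable_centralSeries (by positivity) h)
    (fun k => ?_) ⟨1, by simpa using hK⟩ ?_
  · split_ifs with hk
    · simp [hk]
    · exact mul_le_mul_of_nonneg_right
        (eConst_div_lt_centralRatio (Nat.one_le_iff_ne_zero.2 hk)).le (by positivity)
  · simp only [one_ne_zero, if_false, centralRatio_one, pow_one, Nat.cast_one, Real.sqrt_one,
      div_one]
    exact le_of_eq (by ring)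

theorem centralSeries_add_le (hN : 1 ≤ N) (hB : B ∈ matrixSpace N) (hK : 1 ≤ K) {γ : ℝ}
    (hγ : 0 < γ) (h : 2 * γ * bMax B < 1) :
    centralSeries K (2 * γ * bMax B) + (1 / √Real.pi - 1 / 2) * (2 * γ * bMax B) ≤
      cTwo K γ 0 B := by
  have hb := (bMin_pos hN hB).trans_le (bMin_le_bMax hN)
  have hs := hasSum_cTwo (K := K) hN hB hγ h
  rw [← hs.tsum_eq]
  refine tsum_add_le_tsum_of_le (summable_centralSeries (by positivity) h) hs.summable
    (fun k => ?_) ⟨1, by simpa using hK⟩ ?_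
  · split_ifs with hk
    · simp [hk]
    · exact mul_le_mul_of_nonneg_right
        (centralRatio_le (Nat.one_le_iff_ne_zero.2 hk)) (by positivity)
  · simp only [one_ne_zero, if_false, centralRatio_one, pow_one, Nat.cast_one, Real.sqrt_one,
      div_one]
    exact le_of_eq (by ring)

theorem one_lt_sqrt_pi : 1 < √Real.pi := by
  rw [Real.lt_sqrt (by norm_num)]
  linarith [Real.pi_gt_three]

theorem cTwo_le_two (hN : 1 ≤ N) (hB : B ∈ matrixSpace N) {γ : ℝ} (hγ : 0 < γ)
    (h : 2 * γ * bMax B ≤ 1 / 2) : cTwo K γ 0 B ≤ 2 := by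
  have hb := (bMin_pos hN hB).trans_le (bMin_le_bMax hN)
  have hp : polylog (1 / 2 - 0) K (2 * γ * bMax B) ≤ 1 := by
    rw [polylog_eq_tsum]
    have hg : HasSum (fun n : ℕ => ((1 : ℝ) / 2) ^ n * (1 / 2)) (2 * (1 / 2)) :=
      hasSum_geometric_two.mul_right _
    have hg' : HasSum (fun n : ℕ => if n = 0 then 0 else ((1 : ℝ) / 2) ^ n) 1 := by
      refine (hasSum_nat_add_iff' 1).1 ?_
      convert hg using 1
      · rfl
      · funext n
        simp [pow_succ]
      · norm_num
    refine ((summable_polylogTerm (by positivity) fun _ => by linarith).tsum_le_tsum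
      (fun k => ?_) hg'.summable).trans_eq hg'.tsum_eq
    unfold polylogTerm
    split_ifs with h1 h2 h2
    · omega
    · have hk : (1 : ℝ) ≤ (k : ℝ) ^ ((1 : ℝ) / 2 - 0) :=
        Real.one_le_rpow (by exact_mod_cast h1.1) (by norm_num)
      rw [div_le_iff₀ (by linarith)]
      calc (2 * γ * bMax B) ^ k ≤ (1 / 2) ^ k := by gcongr
        _ ≤ _ := le_mul_of_one_le_right (by positivity) hk
    · exact le_rfl
    · positivity
  have hπ : 1 / √Real.pi ≤ 1 := (div_le_one (by linarith [one_lt_sqrt_pi])).2 one_lt_sqrt_pi.le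
  have hp0 := polylog_nonneg (1 / 2 - 0) K (z := 2 * γ * bMax B) (by positivity)
  unfold cTwo
  nlinarith [mul_le_one₀ hπ hp0 hp]

/-- Each of the first n terms is at least (1/2)/√n. This is what makes R large in part (ii). -/
theorem sqrt_div_two_le_polylog {n : ℕ} (hn : 1 ≤ n) (hK : (n : ℕ∞) ≤ K) {ρ z : ℝ} (hρ : 0 ≤ ρ)
    (hρ1 : ρ ≤ 1) (hρz : ρ ≤ z) (hρn : 1 / 2 ≤ ρ ^ n) (hz : K = ⊤ → z < 1) :
    √n / 2 ≤ polylog (1 / 2) K z := by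
  have hn0 : (0 : ℝ) < n := by exact_mod_cast hn
  have hsn := Real.sqrt_pos.2 hn0
  rw [polylog_eq_tsum]
  refine le_trans ?_ ((summable_polylogTerm (hρ.trans hρz) hz).sum_le_tsum (Icc 1 n)
    fun k _ => polylogTerm_nonneg _ _ (hρ.trans hρz) k)
  calc √n / 2 = ∑ k ∈ Icc 1 n, 1 / 2 / √n := by
        rw [sum_const, Nat.card_Icc, nsmul_eq_mul, Nat.add_sub_cancel]
        nth_rewrite 2 [← Real.mul_self_sqrt hn0.le]
        field_simp
    _ ≤ _ := by
        refine sum_le_sum fun k hk => ?_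
        obtain ⟨h1, h2⟩ := mem_Icc.1 hk
        have hk0 : (0 : ℝ) < k := by exact_mod_cast h1
        rw [polylogTerm_of_le h1 ((Nat.cast_le.2 h2).trans hK), ← Real.sqrt_eq_rpow]
        have : 1 / 2 ≤ z ^ k :=
          hρn.trans ((pow_le_pow_of_le_one hρ hρ1 h2).trans (pow_le_pow_left₀ hρ hρz k))
        gcongr

/-! ### Matrices with nearly constant entries -/

/-- The matrices with entries in `(4ρ / (5N), 4ρ' / (5N))`. -/
def entryBox (N : ℕ) (ρ ρ' : ℝ) : Set (Matrix (Fin N) (Fin N) ℝ) :=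
  {B | ∀ i j, 4 / (5 * N) * ρ < B i j ∧ B i j < 4 / (5 * N) * ρ'}

/-- The value `5N / 16` of `γ_α` and `γ_β`. -/
def gammaVal (N : ℕ) : ℝ := 5 * N / 16

theorem gammaVal_pos (hN : 1 ≤ N) : 0 < gammaVal N := by
  have hN' : (0 : ℝ) < N := by exact_mod_cast hN
  unfold gammaVal; positivity

theorem isOpen_entryBox (N : ℕ) (ρ ρ' : ℝ) : IsOpen (entryBox N ρ ρ') := by
  have : entryBox N ρ ρ' = ⋂ i, ⋂ j, {B : Matrix (Fin N) (Fin N) ℝ |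
      4 / (5 * N) * ρ < B i j ∧ B i j < 4 / (5 * N) * ρ'} := by
    ext B; simp [entryBox]
  rw [this]
  refine isOpen_iInter_of_finite fun i => isOpen_iInter_of_finite fun j => ?_
  have hc : Continuous fun B : Matrix (Fin N) (Fin N) ℝ => B i j :=
    continuous_id.matrix_elem i j
  exact (isOpen_lt continuous_const hc).inter (isOpen_lt hc continuous_const)

theorem lt_four_mul_bMin (hN : 1 ≤ N) {ρ ρ' : ℝ} (hV : B ∈ entryBox N ρ ρ') :
    ρ < 4 * gammaVal N * bMin B := by
  have hN' : (0 : ℝ) < N := by exact_mod_cast hN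
  have h := lt_bMin hN fun i j => (hV i j).1
  calc ρ = 4 * gammaVal N * (4 / (5 * N) * ρ) := by unfold gammaVal; field_simp; norm_num
    _ < _ := by have := gammaVal_pos hN; gcongr

theorem four_mul_bMax_lt (hN : 1 ≤ N) (hB : B ∈ matrixSpace N) {ρ ρ' : ℝ}
    (hV : B ∈ entryBox N ρ ρ') : 4 * gammaVal N * bMax B < ρ' := by
  have hN' : (0 : ℝ) < N := by exact_mod_cast hN
  have h := bMax_lt hN hB.1 fun i j => (hV i j).2
  calc _ < 4 * gammaVal N * (4 / (5 * N) * ρ') := by have := gammaVal_pos hN; gcongr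
    _ = ρ' := by unfold gammaVal; field_simp; norm_num

/-- At b_min = 4/(5N) the ratio to N² is 25/32; lowering b_min by the factor 9/10 still leaves it
below 7/8. -/
theorem two_mul_inv_bMin_le (hN : 1 ≤ N) (hB : B ∈ matrixSpace N) {ρ ρ' : ℝ} (hρ : 9 / 10 ≤ ρ)
    (hV : B ∈ entryBox N ρ ρ') : 2 * gammaVal N * (bMin B)⁻¹ ≤ 7 / 8 * (N : ℝ) ^ 2 := by
  have hN' : (0 : ℝ) < N := by exact_mod_cast hN
  have h := lt_four_mul_bMin hN hV
  have hb := bMin_pos hN hB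
  rw [← div_eq_mul_inv, div_le_iff₀ hb]
  unfold gammaVal at h ⊢
  have h2 : 18 / 25 ≤ N * bMin B := by nlinarith
  have h3 : N * (18 / 25) ≤ N * (N * bMin B) := mul_le_mul_of_nonneg_left h2 hN'.le
  nlinarith

theorem le_dConst_of_mem_entryBox (hN : 1 ≤ N) (hB : B ∈ matrixSpace N) {ρ ρ' : ℝ}
    (hρ' : ρ' ≤ 1) (hV : B ∈ entryBox N ρ ρ') : (3 / 5 : ℝ) ^ N ≤ dConst B := by
  have hN' : (0 : ℝ) < N := by exact_mod_cast hN
  have h := le_dConst (B := B) (c := 4 / (5 * N) * ρ') (r := 4 / 5) (fun i j => (hB.1 i j).le)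
    (fun i j => (hV i j).2.le) (by
      calc (N : ℝ) * (4 / (5 * N) * ρ') = 4 / 5 * ρ' := by field_simp
        _ ≤ _ := by linarith)
  rwa [show (1 - (4 / 5 : ℝ) ^ 2) = (3 / 5) ^ 2 by norm_num, Real.sqrt_sq (by norm_num)] at h

theorem sqrt_pi_lt_two : √Real.pi < 2 := by
  rw [Real.sqrt_lt' (by norm_num)]
  linarith [Real.pi_lt_four]

theorem lowerGap_pos : 0 < 1 / 2 - 1 / √Real.pi * eConst := by
  have h := Real.sqrt_pos.2 Real.pi_pos
  rw [sub_pos, one_div (√Real.pi), inv_mul_lt_iff₀ h]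
  linarith [eConst_lt]

theorem upperGap_pos : 0 < 1 / √Real.pi - 1 / 2 := by
  have h := Real.sqrt_pos.2 Real.pi_pos
  rw [sub_pos]
  exact one_div_lt_one_div_of_lt h sqrt_pi_lt_two

/-- The admissible relative deviation of the coefficients. -/
def margin : ℝ := min (1 / 2 - 1 / √Real.pi * eConst) (1 / √Real.pi - 1 / 2) / 10

theorem margin_pos : 0 < margin := by
  have := lt_min lowerGap_pos upperGap_pos
  unfold margin; positivity

theorem margin_lt_one : margin < 1 := by
  have h1 : 1 / √Real.pi ≤ 1 := (div_le_one (by linarith [one_lt_sqrt_pi])).2 one_lt_sqrt_pi.le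
  have := min_le_right (1 / 2 - 1 / √Real.pi * eConst) (1 / √Real.pi - 1 / 2)
  unfold margin
  linarith

/-- The chain `c_1 < centralSeries ≤ centralSeries < c_2 ≤ 2`, with margins. -/
theorem cOne_cTwo_bounds (hN : 1 ≤ N) (hB : B ∈ matrixSpace N) (hK : 1 ≤ K) {ρ ρ' : ℝ}
    (hρ : 9 / 10 ≤ ρ) (hρ' : ρ' < 1) (hV : B ∈ entryBox N ρ ρ') :
    cOne K (gammaVal N) 0 B + 4 * margin ≤ centralSeries K (2 * gammaVal N * bMin B) ∧
    centralSeries K (2 * gammaVal N * bMin B) ≤ centralSeries K (2 * gammaVal N * bMax B) ∧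
    centralSeries K (2 * gammaVal N * bMax B) + 4 * margin ≤ cTwo K (gammaVal N) 0 B ∧
    cTwo K (gammaVal N) 0 B ≤ 2 := by
  have hγ := gammaVal_pos hN
  have hlo := lt_four_mul_bMin hN hV
  have hhi := four_mul_bMax_lt hN hB hV
  have hbb := bMin_le_bMax (B := B) hN
  have hbb' : 2 * gammaVal N * bMin B ≤ 2 * gammaVal N * bMax B := by gcongr
  have hb := bMin_pos hN hB
  have h1 := cOne_add_le (K := K) hN hB hK hγ (by linarith)
  have h2 := centralSeries_add_le (K := K) hN hB hK hγ (by linarith)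
  have hg1 := lowerGap_pos
  have hg2 := upperGap_pos
  have hm1 : 10 * margin ≤ 1 / 2 - 1 / √Real.pi * eConst := by
    have := min_le_left (1 / 2 - 1 / √Real.pi * eConst) (1 / √Real.pi - 1 / 2)
    unfold margin; linarith
  have hm2 : 10 * margin ≤ 1 / √Real.pi - 1 / 2 := by
    have := min_le_right (1 / 2 - 1 / √Real.pi * eConst) (1 / √Real.pi - 1 / 2)
    unfold margin; linarith
  refine ⟨?_, centralSeries_mono (by positivity) hbb' (by linarith), ?_,
    cTwo_le_two hN hB hγ (by linarith)⟩
  · refine le_trans ?_ h1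
    -- Here 2γ b_min > 9/20, and 2/5 of a gap of size at least 10 `margin` gives the 4 `margin`
    -- claimed.
    have : (1 / 2 - 1 / √Real.pi * eConst) * (2 / 5) ≤
        (1 / 2 - 1 / √Real.pi * eConst) * (2 * gammaVal N * bMin B) :=
      mul_le_mul_of_nonneg_left (by linarith) hg1.le
    linarith
  · refine le_trans ?_ h2
    have : (1 / √Real.pi - 1 / 2) * (2 / 5) ≤ (1 / √Real.pi - 1 / 2) * (2 * gammaVal N * bMax B) :=
      mul_le_mul_of_nonneg_left (by linarith) hg2.le
    linarith

/-- The left side of condition 2 is bounded independently of K and `B`, using d ≥ (3/5)^N and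
monotonicity of G, and c₂ ≤ 2 costs at most 2 log 2 on the right. A large n in the logarithm of R
then wins. -/
theorem mem_matrixSubset_of_mem_entryBox (hN : 1 ≤ N) {ε δ s₁ s₂ : ℝ} (hε : 0 < ε) (hδ : 0 < δ)
    (hs₁ : 0 < s₁) {n : ℕ} (hn : 1 ≤ n) (hK : (n : ℕ∞) ≤ K)
    (hlarge : Real.exp (s₁ / (ε ^ 2 * δ) * (1 / (3 / 5) ^ N) *
        (1 + gFun 0 ⊤ N (√(7 / 8) * N)) + 2 * Real.log 2 + Real.log (ε ^ 2 * δ + 1) +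
        Real.log (max s₂ 1)) ≤ 1 / √Real.pi * eConst * (√n / 2))
    {ρ ρ' : ℝ} (hρ : 9 / 10 ≤ ρ) (hρn : 1 / 2 ≤ ρ ^ n) (hρ' : ρ' < 1)
    (hB : B ∈ matrixSpace N) (hV : B ∈ entryBox N ρ ρ') :
    B ∈ matrixSubset N K ε δ s₁ s₂ (gammaVal N) (gammaVal N) 0 0 := by
  have hN' : (0 : ℝ) < N := by exact_mod_cast hN
  have hγ := gammaVal_pos hN
  have hlo := lt_four_mul_bMin hN hV
  have hhi := four_mul_bMax_lt hN hB hV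
  have hb := bMin_pos hN hB
  have hbb := bMin_le_bMax (B := B) hN
  have hbb' : 4 * gammaVal N * bMin B ≤ 4 * gammaVal N * bMax B := by gcongr
  have hK1 : 1 ≤ K := le_trans (by exact_mod_cast hn) hK
  obtain ⟨h1, h2, h3, h4⟩ := cOne_cTwo_bounds (K := K) hN hB hK1 hρ hρ' hV
  have hm := margin_pos
  have hc1 := one_le_cOne (K := K) (q := 0) hN hB hγ
  have hc2 := one_le_cTwo (K := K) (q := 0) hN hB hγ
  have hcc : (cTwo K (gammaVal N) 0 B)⁻¹ < (cOne K (gammaVal N) 0 B)⁻¹ := by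
    gcongr
    linarith
  have hd := le_dConst_of_mem_entryBox hN hB hρ'.le hV
  have hd0 : (0 : ℝ) < (3 / 5) ^ N := by positivity
  have hg := two_mul_inv_bMin_le hN hB hρ hV
  refine ⟨hB, hcc, fun k hk hkK => ?_, ?_, fun hKt => ⟨by linarith, ?_⟩⟩
  · have hk0 : (0 : ℝ) < k := by exact_mod_cast hk
    gcongr
  · have hsq : √(7 / 8 : ℝ) < 1 := by
      rw [Real.sqrt_lt' one_pos]; norm_num
    have hG : gFun 0 K N (√(2 * gammaVal N * (bMin B)⁻¹)) ≤ gFun 0 ⊤ N (√(7 / 8) * N) := by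
      refine gFun_mono hN (Real.sqrt_nonneg _) ?_ (by nlinarith)
      rw [Real.sqrt_le_left (by positivity), mul_pow, Real.sq_sqrt (by norm_num)]
      exact hg
    have hG0 := gFun_nonneg (K := K) (N := N) (q := 0)
      (Real.sqrt_nonneg (2 * gammaVal N * (bMin B)⁻¹))
    have hleft : s₁ / (ε ^ 2 * δ) * ((cOne K (gammaVal N) 0 B)⁻¹ / dConst B) *
        (1 + gFun 0 K N (√(2 * gammaVal N * (bMin B)⁻¹))) ≤
        s₁ / (ε ^ 2 * δ) * (1 / (3 / 5) ^ N) * (1 + gFun 0 ⊤ N (√(7 / 8) * N)) := by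
      have := inv_le_one_of_one_le₀ hc1
      have : 0 ≤ (cOne K (gammaVal N) 0 B)⁻¹ := inv_nonneg.2 (by linarith)
      gcongr
    have hlog2 : -Real.log 2 ≤ Real.log (cTwo K (gammaVal N) 0 B)⁻¹ := by
      rw [Real.log_inv]
      exact neg_le_neg (Real.log_le_log (by linarith) h4)
    have hR : 1 / √Real.pi * eConst * (√n / 2) ≤
        2 * eConst * rFun 0 K (4 * gammaVal N * bMin B) := by
      have he := eConst_pos
      rw [two_mul_rFun]
      have hr : rScale 0 = 1 := by simp [rScale]
      have ho : rOrder 0 = 1 / 2 := by simp [rOrder]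
      rw [hr, ho, one_mul]
      gcongr
      exact sqrt_div_two_le_polylog hn hK (by linarith) (by linarith) hlo.le hρn
        fun _ => by linarith
    have hlog := Real.log_le_log (Real.exp_pos _) ((hlarge.trans hR).trans
      (le_add_of_nonneg_left zero_le_one))
    rw [Real.log_exp] at hlog
    have : 0 < s₁ / (ε ^ 2 * δ) := by positivity
    linarith
  · nlinarith

/-! ### Coefficients near a balanced family -/

/-- The level sets of the box: the level sums are close to `γ^k / k!`, and the factorially weighted
ones are not much larger than `m_k γ^k / k!`. -/
def levelBox (N k : ℕ) : Set (Idx N k → ℝ) :=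
  {x | (1 - margin) * (gammaVal N ^ k / (k ! : ℝ)) < ∑ I, x I ∧
    ∑ I, x I < (1 + margin) * (gammaVal N ^ k / (k ! : ℝ)) ∧
    ∑ I, x I * multiFactorial I.1 < (1 + margin) * (gammaVal N ^ k / (k ! : ℝ)) * mIdx N k}

theorem isOpen_levelBox (N k : ℕ) : IsOpen (levelBox N k) := by
  have h1 : Continuous fun x : Idx N k → ℝ => ∑ I, x I := by fun_prop
  have h2 : Continuous fun x : Idx N k → ℝ => ∑ I, x I * multiFactorial I.1 := by fun_prop
  exact (isOpen_lt continuous_const h1).inter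
    ((isOpen_lt h1 continuous_const).inter (isOpen_lt h2 continuous_const))

/-- The families with all levels in `levelBox`. -/
def coeffBox (N : ℕ) (K : ℕ∞) : Set (Coeff N K) := {a | ∀ k : Level K, a k ∈ levelBox N k.1}

/-- For K = ∞ this restricts infinitely many factors at once, which the box topology permits. -/
theorem isOpen_coeffBox (N : ℕ) (K : ℕ∞) : IsOpen (coeffBox N K) := by
  refine TopologicalSpace.isOpen_generateFrom_of_mem
    ⟨fun k => levelBox N k.1, fun k => isOpen_levelBox N k.1, ?_⟩
  ext a
  exact ⟨fun h k _ => h k, fun h k => h k (Set.mem_univ k)⟩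

theorem gamma_pow_mul_oddFactorial (γ b : ℝ) (k : ℕ) :
    γ ^ k / (k ! : ℝ) * (b ^ k * oddFactorial k) = centralRatio k * (2 * γ * b) ^ k := by
  have : (k ! : ℝ) ≠ 0 := by positivity
  rw [oddFactorial_eq, mul_pow, mul_pow]
  field_simp

theorem coeffConditions_of_mem_coeffBox (hN : 1 ≤ N) (hK : 1 ≤ K) {ρ ρ' : ℝ}
    (hρ : 9 / 10 ≤ ρ) (hρ' : ρ' < 1) (hB : B ∈ matrixSpace N) (hV : B ∈ entryBox N ρ ρ')
    (ha : Nonneg a) (hU : a ∈ coeffBox N K) :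
    CoeffConditions (gammaVal N) (gammaVal N) 0 0 a B := by
  have hγ := gammaVal_pos hN
  have hhi := four_mul_bMax_lt hN hB hV
  have hb := bMin_pos hN hB
  have hbb := bMin_le_bMax (B := B) hN
  have hbM := hb.trans_le hbb
  have hbb' : 2 * gammaVal N * bMin B ≤ 2 * gammaVal N * bMax B := by gcongr
  obtain ⟨h1, h2, h3, h4⟩ := cOne_cTwo_bounds (K := K) hN hB hK hρ hρ' hV
  have hm := margin_pos
  have hm1 := margin_lt_one
  have hc1 := one_le_cOne (K := K) (q := 0) hN hB hγ
  have hc2 := one_le_cTwo (K := K) (q := 0) hN hB hγ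
  have hsM := summable_centralSeries (K := K) (z := 2 * gammaVal N * bMax B) (by positivity)
    (by linarith)
  have hsm := summable_centralSeries (K := K) (z := 2 * gammaVal N * bMin B) (by positivity)
    (by linarith)
  have hup : ∀ k, muTerm a B k ≤ (1 + margin) * (centralRatio k.1 *
      (2 * gammaVal N * bMax B) ^ k.1) := fun k => by
    have ho := (oddFactorial_pos k.1).le
    rw [← gamma_pow_mul_oddFactorial, ← mul_assoc]
    refine (muTerm_le (fun i j => (hB.1 i j).le) (le_bMax B) ha k).trans ?_
    exact mul_le_mul_of_nonneg_right (hU k).2.1.le (by positivity)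
  have hlow : ∀ k, (1 - margin) * (centralRatio k.1 *
      (2 * gammaVal N * bMin B) ^ k.1) ≤ muTerm a B k := fun k => by
    have ho := (oddFactorial_pos k.1).le
    rw [← gamma_pow_mul_oddFactorial, ← mul_assoc]
    refine le_trans ?_ (le_muTerm hb.le (bMin_le B) ha k)
    exact mul_le_mul_of_nonneg_right (hU k).1.le (by positivity)
  have hμs : Summable (muTerm a B) :=
    (hsM.mul_left (1 + margin)).of_nonneg_of_le (muTerm_nonneg hN hB ha) hup
  have hμu : muHaf a B ≤ (1 + margin) * centralSeries K (2 * gammaVal N * bMax B) := by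
    rw [centralSeries, ← tsum_mul_left]
    exact hμs.tsum_le_tsum hup (hsM.mul_left _)
  have hμl : (1 - margin) * centralSeries K (2 * gammaVal N * bMin B) ≤ muHaf a B := by
    rw [centralSeries, ← tsum_mul_left]
    exact (hsm.mul_left _).tsum_le_tsum hlow hμs
  -- With η = `margin`, (1+η)(c₂ - 4η) ≤ (1-η)c₂ holds because c₂ ≤ 2; the companion bound for c₁
  -- likewise uses that both c₁ and the central series are at most 2.
  have hlo' : (cTwo K (gammaVal N) 0 B)⁻¹ * muHaf a B ≤ 1 - margin := by
    rw [inv_mul_le_iff₀ (by linarith)]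
    nlinarith
  have hhi' : 1 + margin ≤ (cOne K (gammaVal N) 0 B)⁻¹ * muHaf a B := by
    rw [le_inv_mul_iff₀ (by linarith)]
    nlinarith
  have h0 := hU ⟨0, by simp⟩
  have hz : ∑ I, a ⟨0, by simp⟩ I = coeffZero a := sum_coeff_zero a ⟨0, by simp⟩ rfl
  have h0l : 1 - margin < coeffZero a := by
    have := h0.1
    rw [hz] at this
    simpa using this
  have h0u : coeffZero a < 1 + margin := by
    have := h0.2.1
    rw [hz] at this
    simpa using this
  refine ⟨⟨⟨0, by simp⟩, ⟨0, by simp⟩, fun h => ?_⟩, hlo'.trans_lt h0l, h0u.trans_le hhi',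
    fun k _ => ?_⟩
  · have : coeffZero a = 0 := h
    linarith
  · obtain ⟨hk1, hk2, hk3⟩ := hU k
    have hmk : 0 ≤ mIdx N k.1 := by unfold mIdx; positivity
    rw [Real.rpow_zero, one_mul]
    refine ⟨le_trans ?_ hk1.le, hk2.le.trans ?_, hk3.le.trans ?_⟩ <;> gcongr

/-! ### The base point -/

/-- The balanced multi-index with `r_k` entries `s_k + 1` and the others `s_k`. -/
def balancedIdx (N k : ℕ) (i : Fin N) : ℕ := sIdx N k + if (i : ℕ) < rIdx N k then 1 else 0

theorem card_filter_val_lt {r : ℕ} (hr : r ≤ N) :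
    (univ.filter fun i : Fin N => (i : ℕ) < r).card = r := by
  rw [Fin.card_filter_val_lt, min_eq_right hr]

theorem sum_balancedIdx (hN : 1 ≤ N) (k : ℕ) : ∑ i, balancedIdx N k i = 2 * k := by
  simp only [balancedIdx, sum_add_distrib, sum_const, card_univ, Fintype.card_fin, smul_eq_mul]
  rw [← card_filter, card_filter_val_lt (rIdx_le hN), ← two_mul_eq]

theorem multiFactorial_balancedIdx (hN : 1 ≤ N) (k : ℕ) :
    multiFactorial (balancedIdx N k) = mIdx N k := by
  have h : ∀ i : Fin N, ((balancedIdx N k i)! : ℝ) =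
      (sIdx N k)! * if (i : ℕ) < rIdx N k then ((sIdx N k : ℝ) + 1) else 1 := fun i => by
    unfold balancedIdx
    split_ifs
    · rw [Nat.factorial_succ]
      push_cast
      ring
    · simp
  rw [multiFactorial, prod_congr rfl fun i _ => h i, prod_mul_distrib, prod_const, card_univ,
    Fintype.card_fin, prod_ite, prod_const, prod_const_one, mul_one,
    card_filter_val_lt (rIdx_le hN), mIdx]

/-- The family concentrated on the balanced multi-indices. -/
def balancedCoeff (hN : 1 ≤ N) (K : ℕ∞) : Coeff N K := fun k I =>
  if I = ⟨balancedIdx N k.1, sum_balancedIdx hN k.1⟩ then gammaVal N ^ k.1 / (k.1 ! : ℝ) else 0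

theorem balancedCoeff_nonneg (hN : 1 ≤ N) (K : ℕ∞) : Nonneg (balancedCoeff hN K) := fun k I => by
  have := gammaVal_pos hN
  unfold balancedCoeff
  split_ifs <;> positivity

/-- At the balanced multi-index I! equals m_k, so the factorially weighted condition reduces to the
one on the level sum. -/
theorem balancedCoeff_mem (hN : 1 ≤ N) (K : ℕ∞) : balancedCoeff hN K ∈ coeffBox N K := fun k => by
  have hγ := gammaVal_pos hN
  have hg : 0 < gammaVal N ^ k.1 / (k.1 ! : ℝ) := by positivity
  have hm : 0 < mIdx N k.1 := by unfold mIdx; positivity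
  have hη := margin_pos
  simp only [levelBox, balancedCoeff, Set.mem_ofPred_eq, ite_mul, zero_mul, sum_ite_eq', mem_univ,
    if_true, multiFactorial_balancedIdx hN]
  have := mul_pos hη hg
  have := mul_pos this hm
  refine ⟨by linarith, by linarith, by linarith⟩

theorem exists_mem_entryBox (hN : 1 ≤ N) {ρ ρ' : ℝ} (hρ : 0 < ρ) (hρρ : ρ < ρ') (hρ' : ρ' < 1) :
    ∃ B ∈ matrixSpace N, B ∈ entryBox N ρ ρ' := by
  have hN' : (0 : ℝ) < N := by exact_mod_cast hN
  obtain ⟨b, hb1, hb2⟩ : ∃ b, 4 / (5 * N) * ρ < b ∧ b < 4 / (5 * N) * ρ' :=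
    exists_between (by gcongr)
  obtain ⟨c, hc1, hc2⟩ : ∃ c, b < c ∧ c < 4 / (5 * N) * ρ' := exists_between hb2
  have hb0 : 0 < b := lt_trans (by positivity) hb1
  -- The constant matrix b alone is singular for N > 1; adding (c - b) times the identity moves the
  -- spectrum to c - b and c - b + Nb, both positive.
  let B : Matrix (Fin N) (Fin N) ℝ := Matrix.of fun i j => b + if i = j then c - b else 0
  have hV : B ∈ entryBox N ρ ρ' := fun i j => by
    simp only [B, Matrix.of_apply]
    split_ifs
    · constructor <;> linarith
    · constructor <;> linarith
  have hpos : ∀ i j, 0 < B i j := fun i j => lt_trans (by positivity) (hV i j).1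
  refine ⟨B, ⟨hpos, ?_, fun l hl => ⟨?_, ?_⟩⟩, hV⟩
  · ext i j
    simp [B, eq_comm]
  · by_contra hl0
    push Not at hl0
    have h : Module.End.HasEigenvalue (Matrix.toLin' B) l := by
      rw [Module.End.hasEigenvalue_iff_mem_spectrum, Matrix.spectrum_toLin']
      exact hl
    obtain ⟨v, hv⟩ := h.exists_hasEigenvector
    have hv1 : ∀ i, b * ∑ j, v j + (c - b) * v i = l * v i := fun i => by
      have := congrFun hv.apply_eq_smul i
      simpa [B, Matrix.mulVec, dotProduct, add_mul, sum_add_distrib, mul_sum] using this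
    have hS : (l - (c - b)) * ∑ j, v j = N * b * ∑ j, v j := by
      have := sum_congr (s₁ := univ) rfl fun i _ => hv1 i
      rw [sum_add_distrib, ← mul_sum, ← mul_sum, ← mul_sum, sum_const, card_univ,
        Fintype.card_fin, nsmul_eq_mul] at this
      linarith
    have hNb : 0 < N * b := by positivity
    have hS0 : ∑ j, v j = 0 := by
      have : (N * b - (l - (c - b))) * ∑ j, v j = 0 := by linarith
      rcases mul_eq_zero.1 this with h | h
      · linarith
      · exact h
    refine hv.2 (funext fun i => ?_)
    have := hv1 i
    rw [hS0, mul_zero, zero_add] at this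
    have : (l - (c - b)) * v i = 0 := by linarith
    rcases mul_eq_zero.1 this with h | h
    · linarith
    · exact h
  · have h := abs_le_of_mem_spectrum (fun i j => (hpos i j).le) (fun i j => (hV i j).2.le) hl
    have h2 : (N : ℝ) * (4 / (5 * N) * ρ') = 4 / 5 * ρ' := by field_simp
    rw [h2] at h
    linarith [le_abs_self l]

theorem exists_large (c M : ℝ) (hc : 0 < c) : ∃ n : ℕ, 5 ≤ n ∧ M ≤ c * (√n / 2) := by
  obtain ⟨n, hn⟩ := exists_nat_ge ((2 * M / c) ^ 2)
  refine ⟨max 5 n, le_max_left _ _, ?_⟩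
  have h1 : 2 * M / c ≤ √((max 5 n : ℕ) : ℝ) :=
    Real.le_sqrt_of_sq_le (hn.trans (by exact_mod_cast le_max_right 5 n))
  rw [div_le_iff₀ hc] at h1
  linarith

theorem exists_open_problems (hN : 1 ≤ N) {ε δ : ℝ} (hε : 0 < ε) (hδ : 0 < δ) {s₁ : ℝ}
    (hs₁ : 0 < s₁) (s₂ : ℝ) :
    ∃ K₀ : ℕ, ∀ K : ℕ∞, (K₀ : ℕ∞) ≤ K → ∃ γα γβ qα qβ : ℝ, 0 < γα ∧ 0 < γβ ∧
      ∃ U : Set (problemSpace N K), IsOpen U ∧ U.Nonempty ∧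
        ∀ p ∈ U, p.1.2 ∈ matrixSubset N K ε δ s₁ s₂ γα γβ qα qβ ∧
          CoeffConditions γα γβ qα qβ p.1.1 p.1.2 := by
  have hc : 0 < 1 / √Real.pi * eConst := by
    have := Real.sqrt_pos.2 Real.pi_pos
    have := eConst_pos
    positivity
  obtain ⟨n, hn5, hn⟩ := exists_large _ (Real.exp (s₁ / (ε ^ 2 * δ) * (1 / (3 / 5) ^ N) *
    (1 + gFun 0 ⊤ N (√(7 / 8) * N)) + 2 * Real.log 2 + Real.log (ε ^ 2 * δ + 1) +
    Real.log (max s₂ 1))) hc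
  refine ⟨n, fun K hK => ⟨gammaVal N, gammaVal N, 0, 0, gammaVal_pos hN, gammaVal_pos hN, ?_⟩⟩
  have hn1 : 1 ≤ n := by omega
  have hn5' : (5 : ℝ) ≤ n := by exact_mod_cast hn5
  have hn0 : (0 : ℝ) < n := by linarith
  have hK1 : 1 ≤ K := le_trans (by exact_mod_cast hn1) hK
  obtain ⟨ρ, hρ, hρn, hρ1⟩ : ∃ ρ : ℝ, 9 / 10 ≤ ρ ∧ 1 / 2 ≤ ρ ^ n ∧ ρ < 1 := by
    have h10 : 1 / (2 * (n : ℝ)) ≤ 1 / 10 := one_div_le_one_div_of_le (by norm_num) (by linarith)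
    -- Bernoulli's inequality gives (1 - 1/(2n))^n ≥ 1/2, and n ≥ 5 gives the bound 9/10.
    refine ⟨1 + -(1 / (2 * n)), by linarith, ?_, ?_⟩
    · have := one_add_mul_le_pow (a := -(1 / (2 * (n : ℝ)))) (by linarith) n
      refine le_trans (le_of_eq ?_) this
      field_simp
      norm_num
    · have : 0 < 1 / (2 * (n : ℝ)) := by positivity
      linarith
  obtain ⟨ρ', hρρ, hρ'⟩ := exists_between hρ1
  have hsub : ∀ B ∈ matrixSpace N, B ∈ entryBox N ρ ρ' →
      B ∈ matrixSubset N K ε δ s₁ s₂ (gammaVal N) (gammaVal N) 0 0 := fun B hB hV =>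
    mem_matrixSubset_of_mem_entryBox hN hε hδ hs₁ hn1 hK hn hρ hρn hρ' hB hV
  refine ⟨Subtype.val ⁻¹' (coeffBox N K ×ˢ entryBox N ρ ρ'),
    ((isOpen_coeffBox N K).prod (isOpen_entryBox N ρ ρ')).preimage continuous_subtype_val, ?_,
    fun p hp => ⟨hsub _ p.2.1 hp.2,
      coeffConditions_of_mem_coeffBox hN hK1 hρ hρ' p.2.1 hp.2 p.2.2.1 hp.1⟩⟩
  obtain ⟨B, hB, hV⟩ := exists_mem_entryBox hN (by linarith) hρρ hρ'
  have hU := balancedCoeff_mem hN K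
  have ha := balancedCoeff_nonneg hN K
  -- Part (i) supplies the finiteness that places the base point in the problem space.
  have hcs := (coeffSpace_and_sample_size_lt hN hε hδ hs₁ (gammaVal_pos hN) (gammaVal_pos hN)
    (hsub B hB hV) ha (coeffConditions_of_mem_coeffBox hN hK1 hρ hρ' hB hV ha hU)).1
  exact ⟨⟨(balancedCoeff hN K, B), hB, hcs⟩, hU, hV⟩

end GaussExp
end

theorem mainTheorem4 (N : ℕ) (hN : 1 ≤ N) (ε δ s₁ s₂ : ℝ) (hε : 0 < ε) (hε' : ε < 1)
    (hδ : 0 < δ) (hδ' : δ < 1) (hs₁ : 0 < s₁) (hs₂ : 0 < s₂) :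
    (∀ (K : ℕ∞) (γα γβ qα qβ : ℝ), 0 < γα → 0 < γβ →
      ∀ B ∈ GaussExp.matrixSubset N K ε δ s₁ s₂ γα γβ qα qβ,
      ∀ a : GaussExp.Coeff N K, GaussExp.Nonneg a →
        GaussExp.CoeffConditions γα γβ qα qβ a B →
        a ∈ GaussExp.coeffSpace K B ∧
        s₂ * Real.exp (s₁ * GaussExp.nGBSP ε δ a B) < GaussExp.nMC ε δ a B) ∧
    (∃ K₀ : ℕ, ∀ K : ℕ∞, (K₀ : ℕ∞) ≤ K →
      ∃ γα γβ qα qβ : ℝ, 0 < γα ∧ 0 < γβ ∧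
        ∃ U : Set (GaussExp.problemSpace N K), IsOpen U ∧ U.Nonempty ∧
          ∀ p ∈ U, p.1.2 ∈ GaussExp.matrixSubset N K ε δ s₁ s₂ γα γβ qα qβ ∧
            GaussExp.CoeffConditions γα γβ qα qβ p.1.1 p.1.2) :=
  ⟨fun _ _ _ _ _ hα hβ _ hB _ ha h =>
    GaussExp.coeffSpace_and_sample_size_lt hN hε hδ hs₁ hα hβ hB ha h,
    GaussExp.exists_open_problems hN hε hδ hs₁ s₂⟩
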